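/- Let $\mathbb{C}[[x,y_1,y_2]]$ be the algebra of formal power series in three variables, $\mathfrak m$ its maximal ideal, and write $v=y_1y_2$. Let $\widehat{\mathrm{Diff}}_{\mathrm{fib}}$ be the group of formal diffeomorphisms of $\mathbb{C}^3$ fixing the origin and of the form $(x,\mathbf y)\mapsto(x,\phi(x,\mathbf y))$; it acts on formal vector fields vanishing at the origin by conjugacy, $\Phi_*(Y)=(\mathrm D\Phi\cdot Y)\circ\Phi^{-1}$. A doubly-resonant saddle-node is a formal vector field vanishing at the origin of $\mathbb{C}^3$ which is $\widehat{\mathrm{Diff}}_{\mathrm{fib}}$-conjugate to a vector field in prepared form $$x^2\frac{\partial}{\partial x}+\bigl(-\lambda y_1+F_1(x,\mathbf y)\bigr)\frac{\partial}{\partial y_1}+\bigl(\lambda y_2+F_2(x,\mathbf y)\bigr)\frac{\partial}{\partial y_2},\qquad \lambda\in\mathbb{C}^*,\quad F_1,F_2\in\mathfrak m^2 .$$ If $\mathbf A(x)\in \mathrm{Mat}_{2,2}(\mathbb{C}[[x]])$ is the matrix of the part of degree one in $\mathbf y=(y_1,y_2)$ of the $(\partial/\partial y_1,\partial/\partial y_2)$-components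 of such a prepared form, its residue is the complex number $\bigl(\mathrm{Tr}\,\mathbf A(x)/x\bigr)_{|x=0}$. The saddle-node is non-degenerate if the residue of a prepared form of it lies in $\mathbb{C}\setminus\mathbb{Q}_{\le 0}$ (the residue does not depend on the prepared form chosen). Let $\widehat{\mathcal{SN}}_{\mathrm{nd}}$ be the set of non-degenerate doubly-resonant saddle-nodes; it is stable under $\widehat{\mathrm{Diff}}_{\mathrm{fib}}$. Let $$\mathcal P=\bigl\{\mathbf p=(\lambda,a_1,a_2,c_1,c_2)\in\mathbb{C}^*\times\mathbb{C}^2\times(v\,\mathbb{C}[[v]])^2 \;:\; a_1+a_2\notin\mathbb{Q}_{\le 0}\bigr\},$$ and let $\mathbb{C}^*\times\mathbb{Z}/2\mathbb{Z}$ act on $\mathcal P$ by $$\theta\cdot(\lambda,a_1,a_2,c_1,c_2)=\bigl(\lambda,a_1,a_2,c_1(\theta v),c_2(\theta v)\bigr)\quad(\theta\in\mathbb{C}^*),$$ the non-trivial element of $\mathbb{Z}/2\mathbb{Z}$ acting by $(\lambda,a_1,a_2,c_1,c_2)\mapsto(-\lambda,a_2,a_1,c_2,c_1)$. For $\mathbf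 p\in\mathcal P$ let $Z_{\mathbf p}\in\widehat{\mathcal{SN}}_{\mathrm{nd}}$ be the normal form $$Z_{\mathbf p}=x^2\frac{\partial}{\partial x}+\bigl(-\lambda+a_1x+c_1(v)\bigr)y_1\frac{\partial}{\partial y_1}+\bigl(\lambda+a_2x+c_2(v)\bigr)y_2\frac{\partial}{\partial y_2}.$$ Then there exists a bijection $$\widehat{\mathcal{SN}}_{\mathrm{nd}}\big/\widehat{\mathrm{Diff}}_{\mathrm{fib}}\;\simeq\;\mathcal P\big/\bigl(\mathbb{C}^*\times\mathbb{Z}/2\mathbb{Z}\bigr)$$ which, for every $\mathbf p\in\mathcal P$, sends the class of $Z_{\mathbf p}$ to the class of $\mathbf p$. -/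

import Mathlib

namespace SaddleNode

noncomputable section

/-- The algebra `ℂ⟦x, y₁, y₂⟧` of formal power series in three variables. -/
abbrev FormalSeries : Type := MvPowerSeries (Fin 3) ℂ

/-- The coordinate `x`. -/
def x : FormalSeries := MvPowerSeries.X 0

/-- The coordinate `y₁`. -/
def y₁ : FormalSeries := MvPowerSeries.X 1

/-- The coordinate `y₂`. -/
def y₂ : FormalSeries := MvPowerSeries.X 2

/-- The maximal ideal of `ℂ⟦x, y₁, y₂⟧`: the series with zero constant term. -/
abbrev 𝔪 : Ideal FormalSeries := IsLocalRing.maximalIdeal FormalSeries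

/-- Formal vector fields on `(ℂ³, 0)`, seen as derivations of `ℂ⟦x, y₁, y₂⟧`;
`Y f` is the Lie derivative of `f` along `Y`. -/
abbrev VectorField : Type := Derivation ℂ FormalSeries FormalSeries

/-- The vector field `b ∂/∂x + b₁ ∂/∂y₁ + b₂ ∂/∂y₂`. -/
def ofComponents (b b₁ b₂ : FormalSeries) : VectorField :=
  b • MvPowerSeries.pderiv ℂ 0 + b₁ • MvPowerSeries.pderiv ℂ 1 + b₂ • MvPowerSeries.pderiv ℂ 2

/-- A formal vector field is singular if its three components vanish at the origin. -/
def IsSingular (Y : VectorField) : Prop := Y x ∈ 𝔪 ∧ Y y₁ ∈ 𝔪 ∧ Y y₂ ∈ 𝔪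

/-- The group of formal diffeomorphisms of `ℂ³` fixing the origin. A formal diffeomorphism `Φ` is
given by its pull-back `Φ^*`, an automorphism of the `ℂ`-algebra `ℂ⟦x, y₁, y₂⟧`. The opposite
group is taken because `(Φ ∘ Ψ)^* = Ψ^* ∘ Φ^*`: multiplication in `FormalDiffeo` is composition
of diffeomorphisms. -/
def FormalDiffeo : Type := (FormalSeries ≃ₐ[ℂ] FormalSeries)ᵐᵒᵖ

instance : Group FormalDiffeo := inferInstanceAs (Group (FormalSeries ≃ₐ[ℂ] FormalSeries)ᵐᵒᵖ)

/-- The pull-back `Φ^* f = f ∘ Φ`. -/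
def FormalDiffeo.pullback (Φ : FormalDiffeo) : FormalSeries ≃ₐ[ℂ] FormalSeries :=
  MulOpposite.unop Φ

theorem FormalDiffeo.pullback_one (f : FormalSeries) :
    (1 : FormalDiffeo).pullback f = f := rfl

theorem FormalDiffeo.pullback_mul (Φ Ψ : FormalDiffeo) (f : FormalSeries) :
    (Φ * Ψ).pullback f = Ψ.pullback (Φ.pullback f) := rfl

theorem FormalDiffeo.pullback_inv (Φ : FormalDiffeo) : Φ⁻¹.pullback = Φ.pullback.symm := rfl

/-- The push-forward `Φ_* Y = (DΦ · Y) ∘ Φ⁻¹`; as a derivation,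
`Φ_* Y = (Φ⁻¹)^* ∘ Y ∘ Φ^*`. -/
def pushforward (Φ : FormalDiffeo) (Y : VectorField) : VectorField :=
  Derivation.mk' ((Φ.pullback.symm.toLinearMap ∘ₗ (Y : FormalSeries →ₗ[ℂ] FormalSeries)) ∘ₗ
    Φ.pullback.toLinearMap) (by
      intro f g
      simp [Derivation.leibniz, smul_eq_mul])

theorem pushforward_apply (Φ : FormalDiffeo) (Y : VectorField) (f : FormalSeries) :
    pushforward Φ Y f = Φ.pullback.symm (Y (Φ.pullback f)) := rfl

/-- Formal diffeomorphisms act on formal vector fields by conjugacy. -/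
instance : MulAction FormalDiffeo VectorField where
  smul := pushforward
  one_smul _ := Derivation.ext fun _ => rfl
  mul_smul _ _ _ := Derivation.ext fun _ => rfl

theorem smul_eq_pushforward (Φ : FormalDiffeo) (Y : VectorField) : Φ • Y = pushforward Φ Y := rfl

/-- The group of fibered formal diffeomorphisms `(x, y) ↦ (x, φ(x, y))`, that is `Φ^* x = x`. -/
def FiberedDiffeo : Subgroup FormalDiffeo where
  carrier := {Φ | Φ.pullback x = x}
  one_mem' := rfl
  mul_mem' := by
    intro Φ Ψ hΦ hΨ
    simp only [Set.mem_ofPred_eq] at hΦ hΨ ⊢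
    rw [FormalDiffeo.pullback_mul, hΦ, hΨ]
  inv_mem' := by
    intro Φ hΦ
    simp only [Set.mem_ofPred_eq] at hΦ ⊢
    rw [FormalDiffeo.pullback_inv, AlgEquiv.symm_apply_eq, hΦ]

/-- `Y = x² ∂/∂x + (-λ y₁ + F₁) ∂/∂y₁ + (λ y₂ + F₂) ∂/∂y₂` with `λ ≠ 0` and `F₁, F₂ ∈ 𝔪²`. -/
def IsPrepared (Y : VectorField) : Prop :=
  ∃ lam : ℂ, lam ≠ 0 ∧ ∃ F₁ ∈ 𝔪 ^ 2, ∃ F₂ ∈ 𝔪 ^ 2,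
    Y = ofComponents (x ^ 2) (-(lam • y₁) + F₁) (lam • y₂ + F₂)

/-- Doubly-resonant saddle-nodes. -/
def IsSaddleNode (Y : VectorField) : Prop :=
  IsSingular Y ∧ ∃ Φ : FiberedDiffeo, IsPrepared (Φ • Y)

/-- The matrix `A(x)` of the part of degree one in `y = (y₁, y₂)` of the `y`-components of `Y`:
the entry `(i, j)` is the coefficient in `ℂ⟦x⟧` of `y_j` in the `y_i`-component. -/
def linearPart (Y : VectorField) : Matrix (Fin 2) (Fin 2) (PowerSeries ℂ) :=
  Matrix.of fun i j => PowerSeries.mk fun n =>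
    MvPowerSeries.coeff (Finsupp.single 0 n + Finsupp.single j.succ 1)
      (Y (MvPowerSeries.X i.succ))

/-- The value at `x = 0` of `Tr A(x) / x`, for `Y` in prepared form (where `Tr A(0) = 0`). -/
def preparedResidue (Y : VectorField) : ℂ :=
  PowerSeries.coeff 1 (linearPart Y).trace

/-- `r` is the residue of `Y`, computed on a prepared form of `Y`
(the result is the same for all prepared forms). -/
def HasResidue (Y : VectorField) (r : ℂ) : Prop :=
  ∃ Φ : FiberedDiffeo, IsPrepared (Φ • Y) ∧ preparedResidue (Φ • Y) = r

/-- The complex number `z` is a rational number `≤ 0`. -/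
def IsNonposRat (z : ℂ) : Prop := ∃ q : ℚ, q ≤ 0 ∧ z = q

/-- Non-degenerate doubly-resonant saddle-nodes. -/
def IsNondegenerate (Y : VectorField) : Prop :=
  IsSaddleNode Y ∧ ∃ r : ℂ, HasResidue Y r ∧ ¬ IsNonposRat r

theorem mem_maximalIdeal_iff (f : FormalSeries) :
    f ∈ 𝔪 ↔ MvPowerSeries.constantCoeff f = 0 := by
  rw [IsLocalRing.mem_maximalIdeal, mem_nonunits_iff, MvPowerSeries.isUnit_iff_constantCoeff,
    isUnit_iff_ne_zero, not_not]

theorem x_mem : x ∈ 𝔪 := by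
  rw [mem_maximalIdeal_iff, x, MvPowerSeries.constantCoeff_X]

theorem y₁_mem : y₁ ∈ 𝔪 := by
  rw [mem_maximalIdeal_iff, y₁, MvPowerSeries.constantCoeff_X]

theorem y₂_mem : y₂ ∈ 𝔪 := by
  rw [mem_maximalIdeal_iff, y₂, MvPowerSeries.constantCoeff_X]

theorem map_mem_maximalIdeal (g : FormalSeries ≃ₐ[ℂ] FormalSeries) {f : FormalSeries}
    (hf : f ∈ 𝔪) : g f ∈ 𝔪 := by
  rw [IsLocalRing.mem_maximalIdeal, mem_nonunits_iff] at hf ⊢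
  rwa [MulEquiv.isUnit_map g]

theorem isSingular_of_isPrepared {Y : VectorField} (h : IsPrepared Y) :
    ∀ f ∈ 𝔪, Y f ∈ 𝔪 := by
  obtain ⟨lam, -, F₁, h₁, F₂, h₂, rfl⟩ := h
  have e₁ : -(lam • y₁) + F₁ ∈ 𝔪 :=
    add_mem (neg_mem (Submodule.smul_of_tower_mem 𝔪 lam y₁_mem)) (Ideal.pow_le_self two_ne_zero h₁)
  have e₂ : lam • y₂ + F₂ ∈ 𝔪 :=
    add_mem (Submodule.smul_of_tower_mem 𝔪 lam y₂_mem) (Ideal.pow_le_self two_ne_zero h₂)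
  intro f _
  simp only [ofComponents, Derivation.add_apply, Derivation.smul_apply, smul_eq_mul]
  exact add_mem (add_mem (Ideal.mul_mem_right _ _ (Ideal.pow_mem_of_mem _ x_mem 2 two_pos))
    (Ideal.mul_mem_right _ _ e₁)) (Ideal.mul_mem_right _ _ e₂)

/-- The set of non-degenerate doubly-resonant saddle-nodes, with the action of the fibered
diffeomorphisms by conjugacy. -/
def SNnd : SubMulAction FiberedDiffeo VectorField where
  carrier := {Y | IsNondegenerate Y}
  smul_mem' := by
    rintro Ψ Y ⟨⟨-, Φ, hΦ⟩, r, ⟨Φ', hΦ', hr⟩, hr'⟩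
    have key : ∀ Θ : FiberedDiffeo, (Θ * Ψ⁻¹) • (Ψ • Y) = Θ • Y := by
      intro Θ
      rw [smul_smul, inv_mul_cancel_right]
    refine ⟨⟨?_, Φ * Ψ⁻¹, by rwa [key]⟩, r, ⟨Φ' * Ψ⁻¹, by rwa [key], by rwa [key]⟩, hr'⟩
    have e : Ψ • Y = (Ψ * Φ⁻¹) • (Φ • Y) := by rw [smul_smul, inv_mul_cancel_right]
    have hm : ∀ f ∈ 𝔪, (Ψ • Y) f ∈ 𝔪 := by
      intro f hf
      rw [e]
      exact map_mem_maximalIdeal (Ψ * Φ⁻¹ : FiberedDiffeo).1.pullback.symm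
        (isSingular_of_isPrepared hΦ _
          (map_mem_maximalIdeal (Ψ * Φ⁻¹ : FiberedDiffeo).1.pullback hf))
    exact ⟨hm _ x_mem, hm _ y₁_mem, hm _ y₂_mem⟩

/-- The parameter space: `(λ, a₁, a₂, c₁, c₂)` with `λ ≠ 0`, `a₁ + a₂` not a rational number
`≤ 0`, and `c₁, c₂ ∈ v ℂ⟦v⟧`. -/
@[ext]
structure ParamSpace where
  lam : ℂ
  a₁ : ℂ
  a₂ : ℂ
  c₁ : PowerSeries ℂ
  c₂ : PowerSeries ℂ
  lam_ne_zero : lam ≠ 0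
  nondeg : ¬ IsNonposRat (a₁ + a₂)
  c₁_zero : PowerSeries.constantCoeff c₁ = 0
  c₂_zero : PowerSeries.constantCoeff c₂ = 0

/-- `θ · (λ, a₁, a₂, c₁, c₂) = (λ, a₁, a₂, c₁(θ v), c₂(θ v))`. -/
instance : MulAction ℂˣ ParamSpace where
  smul θ p :=
    { lam := p.lam
      a₁ := p.a₁
      a₂ := p.a₂
      c₁ := PowerSeries.rescale (θ : ℂ) p.c₁
      c₂ := PowerSeries.rescale (θ : ℂ) p.c₂
      lam_ne_zero := p.lam_ne_zero
      nondeg := p.nondeg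
      c₁_zero := by
        rw [← PowerSeries.coeff_zero_eq_constantCoeff_apply, PowerSeries.coeff_rescale]
        simpa using p.c₁_zero
      c₂_zero := by
        rw [← PowerSeries.coeff_zero_eq_constantCoeff_apply, PowerSeries.coeff_rescale]
        simpa using p.c₂_zero }
  one_smul p := ParamSpace.ext rfl rfl rfl
    (by change PowerSeries.rescale ((1 : ℂˣ) : ℂ) p.c₁ = p.c₁; simp)
    (by change PowerSeries.rescale ((1 : ℂˣ) : ℂ) p.c₂ = p.c₂; simp)
  mul_smul θ η p := ParamSpace.ext rfl rfl rfl
    (by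
      change PowerSeries.rescale ((θ * η : ℂˣ) : ℂ) p.c₁ =
        PowerSeries.rescale (θ : ℂ) (PowerSeries.rescale (η : ℂ) p.c₁)
      rw [PowerSeries.rescale_rescale, Units.val_mul, mul_comm])
    (by
      change PowerSeries.rescale ((θ * η : ℂˣ) : ℂ) p.c₂ =
        PowerSeries.rescale (θ : ℂ) (PowerSeries.rescale (η : ℂ) p.c₂)
      rw [PowerSeries.rescale_rescale, Units.val_mul, mul_comm])

/-- The involution `(λ, a₁, a₂, c₁, c₂) ↦ (-λ, a₂, a₁, c₂, c₁)`. -/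
def ParamSpace.swap (p : ParamSpace) : ParamSpace where
  lam := -p.lam
  a₁ := p.a₂
  a₂ := p.a₁
  c₁ := p.c₂
  c₂ := p.c₁
  lam_ne_zero := neg_ne_zero.mpr p.lam_ne_zero
  nondeg := by rw [add_comm]; exact p.nondeg
  c₁_zero := p.c₂_zero
  c₂_zero := p.c₁_zero

theorem ParamSpace.swap_swap (p : ParamSpace) : p.swap.swap = p :=
  ParamSpace.ext (neg_neg _) rfl rfl rfl rfl

theorem ParamSpace.swap_smul (θ : ℂˣ) (p : ParamSpace) : (θ • p).swap = θ • p.swap := rfl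

/-- The group `ℤ/2ℤ` (written multiplicatively) acts on the parameter space through `swap`. -/
instance : MulAction (Multiplicative (ZMod 2)) ParamSpace where
  smul ε p := if ε.toAdd = 0 then p else p.swap
  one_smul _ := rfl
  mul_smul ε δ p := by
    change (if (ε * δ).toAdd = 0 then p else p.swap) =
      if ε.toAdd = 0 then (if δ.toAdd = 0 then p else p.swap)
        else (if δ.toAdd = 0 then p else p.swap).swap
    have h2 : ∀ a b : ZMod 2, a ≠ 0 → b ≠ 0 → a + b = 0 := by decide
    rw [toAdd_mul]
    by_cases hε : ε.toAdd = 0 <;> by_cases hδ : δ.toAdd = 0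
    · simp [hε, hδ]
    · simp [hε, hδ]
    · simp [hε, hδ]
    · simp [hε, hδ, h2 _ _ hε hδ, ParamSpace.swap_swap]

instance : SMulCommClass ℂˣ (Multiplicative (ZMod 2)) ParamSpace where
  smul_comm θ ε p := by
    change θ • (if ε.toAdd = 0 then p else p.swap) = if ε.toAdd = 0 then θ • p else (θ • p).swap
    split_ifs <;> rfl

/-- The action of `ℂ^* × ℤ/2ℤ` on the parameter space: `(θ, ε) · p = θ · (ε · p)`. -/
instance : MulAction (ℂˣ × Multiplicative (ZMod 2)) ParamSpace :=
  MulAction.prodOfSMulCommClass ℂˣ (Multiplicative (ZMod 2)) ParamSpace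

/-- The power series `c(v)` in `ℂ⟦x, y₁, y₂⟧`, where `v = y₁ y₂`. -/
def atV (c : PowerSeries ℂ) : FormalSeries := c.subst (y₁ * y₂)

/-- The normal form with parameters `p`:
`x² ∂/∂x + (-λ + a₁ x + c₁(v)) y₁ ∂/∂y₁ + (λ + a₂ x + c₂(v)) y₂ ∂/∂y₂`. -/
def normalFormField (p : ParamSpace) : VectorField :=
  ofComponents (x ^ 2)
    ((-MvPowerSeries.C p.lam + MvPowerSeries.C p.a₁ * x + atV p.c₁) * y₁)
    ((MvPowerSeries.C p.lam + MvPowerSeries.C p.a₂ * x + atV p.c₂) * y₂)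

theorem hasSubst_v : PowerSeries.HasSubst (y₁ * y₂ : FormalSeries) :=
  PowerSeries.HasSubst.of_constantCoeff_zero (by simp [y₁])

theorem atV_eq_mul {c : PowerSeries ℂ} (hc : PowerSeries.constantCoeff c = 0) :
    ∃ h : FormalSeries, atV c = y₁ * y₂ * h := by
  obtain ⟨d, rfl⟩ := PowerSeries.X_dvd_iff.mpr hc
  exact ⟨atV d, by rw [atV, PowerSeries.subst_mul hasSubst_v, PowerSeries.subst_X hasSubst_v]; rfl⟩

theorem isPrepared_normalFormField (p : ParamSpace) : IsPrepared (normalFormField p) := by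
  have aux : ∀ (a : ℂ) (c : PowerSeries ℂ), PowerSeries.constantCoeff c = 0 →
      MvPowerSeries.C a * x + atV c ∈ 𝔪 := by
    intro a c hc
    obtain ⟨h, hh⟩ := atV_eq_mul hc
    rw [hh]
    exact add_mem (Ideal.mul_mem_left _ _ x_mem)
      (Ideal.mul_mem_right _ _ (Ideal.mul_mem_right _ _ y₁_mem))
  refine ⟨p.lam, p.lam_ne_zero, (MvPowerSeries.C p.a₁ * x + atV p.c₁) * y₁, ?_,
    (MvPowerSeries.C p.a₂ * x + atV p.c₂) * y₂, ?_, ?_⟩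
  · rw [sq]
    exact Ideal.mul_mem_mul (aux _ _ p.c₁_zero) y₁_mem
  · rw [sq]
    exact Ideal.mul_mem_mul (aux _ _ p.c₂_zero) y₂_mem
  · rw [normalFormField, MvPowerSeries.smul_eq_C_mul, MvPowerSeries.smul_eq_C_mul]
    congr 1 <;> ring

theorem ofComponents_y₁ (b b₁ b₂ : FormalSeries) :
    ofComponents b b₁ b₂ (MvPowerSeries.X 1) = b₁ := by
  simp [ofComponents]

theorem ofComponents_y₂ (b b₁ b₂ : FormalSeries) :
    ofComponents b b₁ b₂ (MvPowerSeries.X 2) = b₂ := by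
  simp [ofComponents]

theorem coeff_normalForm_component (l a : ℂ) (c : PowerSeries ℂ)
    (hc : PowerSeries.constantCoeff c = 0) (s : Fin 3) :
    MvPowerSeries.coeff (Finsupp.single 0 1 + Finsupp.single s 1)
      ((MvPowerSeries.C l + MvPowerSeries.C a * x + atV c) * MvPowerSeries.X s) = a := by
  obtain ⟨h, hh⟩ := atV_eq_mul hc
  have h0 : MvPowerSeries.coeff (Finsupp.single (0 : Fin 3) 1) (atV c) = 0 := by
    have hd : (MvPowerSeries.X 1 : FormalSeries) ∣ atV c :=
      ⟨y₂ * h, by rw [hh, y₁, mul_assoc]⟩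
    exact MvPowerSeries.X_dvd_iff.mp hd _ (by simp)
  rw [MvPowerSeries.X, MvPowerSeries.coeff_add_mul_monomial]
  simp [h0, x, MvPowerSeries.coeff_C]

theorem preparedResidue_normalFormField (p : ParamSpace) :
    preparedResidue (normalFormField p) = p.a₁ + p.a₂ := by
  have h₁ := coeff_normalForm_component (-p.lam) p.a₁ p.c₁ p.c₁_zero 1
  have h₂ := coeff_normalForm_component p.lam p.a₂ p.c₂ p.c₂_zero 2
  rw [preparedResidue, Matrix.trace_fin_two, map_add, linearPart]
  simp only [Matrix.of_apply, PowerSeries.coeff_mk, Fin.succ_zero_eq_one, Fin.succ_one_eq_two]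
  rw [normalFormField, ofComponents_y₁, ofComponents_y₂, ← map_neg]
  exact congrArg₂ (· + ·) h₁ h₂

theorem isNondegenerate_normalFormField (p : ParamSpace) :
    IsNondegenerate (normalFormField p) := by
  have h := isPrepared_normalFormField p
  have hm := isSingular_of_isPrepared h
  refine ⟨⟨⟨hm _ x_mem, hm _ y₁_mem, hm _ y₂_mem⟩, 1, by rwa [one_smul]⟩,
    p.a₁ + p.a₂, ⟨1, by rwa [one_smul], ?_⟩, p.nondeg⟩
  rw [one_smul, preparedResidue_normalFormField]

/-- The normal form with parameters `p`, as a non-degenerate doubly-resonant saddle-node. -/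
def normalForm (p : ParamSpace) : SNnd :=
  ⟨normalFormField p, isNondegenerate_normalFormField p⟩

end

end SaddleNode

namespace SaddleNode

noncomputable section

open MvPowerSeries Finsupp

/-! Existence. Split a prepared field as S + N with S = -λ y₁ ∂/∂y₁ + λ y₂ ∂/∂y₂ and x² ∂/∂x counted
in N. S multiplies x^a y₁^b y₂^c by λ (c - b), so its kernel consists of the series in x and v = y₁
y₂. Poincaré–Dulac elimination (`exists_smul_eq_resonant`) leaves y-components of the form Aᵢ(x, v)
yᵢ and keeps the coefficients aᵢ of x yᵢ, whose sum is the residue. A further change yᵢ ↦ (1 + Uᵢ(x,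
v)) yᵢ involves the operator x² ∂/∂x + (a₁ + a₂) x y₁ ∂/∂y₁, which sends x^k v^m to (k + (a₁ + a₂)
m) x^(k+1) v^m. Non-degeneracy says that this scalar vanishes only for k = m = 0, so every remaining
term divisible by x can be removed (`exists_smul_eq_normal`). Each of the two steps solves its whole
conjugacy equation at once: the diffeomorphism and the new field together are the fixed point of an
𝔪-adic contraction (`exists_fixedPoint`).

Uniqueness. Comparing linear parts, a conjugacy of normal forms preserves λ up to sign, and
exchanging y₁ and y₂ reduces to equal λ. Since S is diagonal and commutes with N, the conjugacy then
preserves S (`linearField_of_related`), so it has the form yᵢ ↦ fᵢ(x, v) yᵢ. The operator above,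
applied to fᵢ, only produces multiples of x, whereas it has to compensate differences of series in v
alone. Hence fᵢ is a constant βᵢ, and the cᵢ differ by the rescaling v ↦ β₁ β₂ v
(`exists_rescale_of_related`).

Conjugacies are treated as abstract algebra endomorphisms. Order estimates pass from the coordinates
to all series by the product rule (`IsSkew`), without any continuity assumption. -/

/-! ### The 𝔪-adic filtration in terms of coefficients -/

theorem coeff_X_mul_eq (i : Fin 3) (e : Fin 3 →₀ ℕ) (f : FormalSeries) :
    coeff e (X i * f) = if e i = 0 then 0 else coeff (e - single i 1) f := by
  classical
  rw [X, coeff_monomial_mul]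
  simp only [Finsupp.single_le_iff, one_mul, Nat.one_le_iff_ne_zero, ite_not]

theorem degree_eq_sum (e : Fin 3 →₀ ℕ) : e.degree = e 0 + e 1 + e 2 := by
  rw [Finsupp.degree_eq_sum, Fin.sum_univ_three]

theorem exists_eq_sum_X_mul {n : ℕ} {f : FormalSeries}
    (hf : ∀ e : Fin 3 →₀ ℕ, e.degree < n + 1 → coeff e f = 0) :
    ∃ g : Fin 3 → FormalSeries, f = ∑ i, X i * g i ∧
      ∀ i, ∀ e : Fin 3 →₀ ℕ, e.degree < n → coeff e (g i) = 0 := by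
  -- Each monomial of `f` is assigned to the first variable that divides it, so none is counted
  -- twice.
  refine ⟨![fun e => coeff (e + single 0 1) f,
    fun e => if e 0 = 0 then coeff (e + single 1 1) f else 0,
    fun e => if e 0 = 0 ∧ e 1 = 0 then coeff (e + single 2 1) f else 0], ?_, ?_⟩
  · ext e
    have key : ∀ i : Fin 3, e i ≠ 0 → e - single i 1 + single i 1 = e := fun i hi =>
      tsub_add_cancel_of_le (Finsupp.single_le_iff.mpr (Nat.one_le_iff_ne_zero.mpr hi))
    have hsub : ∀ i j : Fin 3, i ≠ j → (e - single i 1 : Fin 3 →₀ ℕ) j = e j := fun i j hij => by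
      simp [Finsupp.single_eq_of_ne' hij]
    rw [Fin.sum_univ_three, map_add, map_add, coeff_X_mul_eq, coeff_X_mul_eq, coeff_X_mul_eq]
    simp only [Matrix.cons_val]
    change coeff e f = (if e 0 = 0 then 0 else coeff (e - single 0 1 + single 0 1) f) +
      (if e 1 = 0 then 0 else if (e - single 1 1 : Fin 3 →₀ ℕ) 0 = 0 then
        coeff (e - single 1 1 + single 1 1) f else 0) +
      (if e 2 = 0 then 0 else if (e - single 2 1 : Fin 3 →₀ ℕ) 0 = 0 ∧ (e - single 2 1 : Fin 3 →₀ ℕ) 1 = 0 then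
        coeff (e - single 2 1 + single 2 1) f else 0)
    rw [hsub 1 0 (by decide), hsub 2 0 (by decide), hsub 2 1 (by decide)]
    by_cases h0 : e 0 = 0 <;> by_cases h1 : e 1 = 0 <;> by_cases h2 : e 2 = 0 <;>
      simp only [h0, h1, h2, key, if_true, if_false, ne_eq, not_false_eq_true, true_and,
        false_and, and_self, add_zero, zero_add]
    exact hf e (by rw [degree_eq_sum, h0, h1, h2]; omega)
  · intro i e he
    have hd : ∀ j : Fin 3, (e + single j 1).degree < n + 1 := fun j => by
      rw [map_add, Finsupp.degree_single]; omega
    fin_cases i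
    · exact hf _ (hd 0)
    · change (if e 0 = 0 then coeff (e + single 1 1) f else 0) = 0
      rw [hf _ (hd 1), ite_self]
    · change (if e 0 = 0 ∧ e 1 = 0 then coeff (e + single 2 1) f else 0) = 0
      rw [hf _ (hd 2), ite_self]

theorem X_mem (i : Fin 3) : (X i : FormalSeries) ∈ 𝔪 := by
  rw [mem_maximalIdeal_iff, constantCoeff_X]

/-- Membership in `𝔪 ^ n` means that all coefficients of degree `< n` vanish. -/
theorem mem_pow_iff {n : ℕ} {f : FormalSeries} :
    f ∈ 𝔪 ^ n ↔ ∀ e : Fin 3 →₀ ℕ, e.degree < n → coeff e f = 0 := by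
  constructor
  · intro hf
    suffices h : (n : ℕ∞) ≤ f.order from
      fun e he => coeff_of_lt_order (lt_of_lt_of_le (by exact_mod_cast he) h)
    induction n generalizing f with
    | zero => simp
    | succ n ih =>
      rw [pow_succ] at hf
      refine Submodule.mul_induction_on hf (fun a ha b hb => ?_)
        (fun a b ha hb => (le_min ha hb).trans min_order_le_add)
      have hb' : (1 : ℕ∞) ≤ b.order :=
        one_le_order_iff_constCoeff_eq_zero.mpr ((mem_maximalIdeal_iff b).mp hb)
      refine le_trans ?_ le_order_mul
      push_cast
      exact add_le_add (ih ha) hb'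
  · induction n generalizing f with
    | zero => simp
    | succ n ih =>
      intro hf
      obtain ⟨g, rfl, hg⟩ := exists_eq_sum_X_mul hf
      rw [pow_succ']
      exact sum_mem fun i _ => Ideal.mul_mem_mul (X_mem i) (ih (hg i))

theorem exists_X_mul_of_mem_pow {n : ℕ} {f : FormalSeries} (hf : f ∈ 𝔪 ^ (n + 1)) :
    ∃ g : Fin 3 → FormalSeries, f = ∑ i, X i * g i ∧ ∀ i, g i ∈ 𝔪 ^ n := by
  obtain ⟨g, h, hg⟩ := exists_eq_sum_X_mul (mem_pow_iff.mp hf)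
  exact ⟨g, h, fun i => mem_pow_iff.mpr (hg i)⟩

theorem eq_zero_of_forall_mem_pow {f : FormalSeries} (h : ∀ n, f ∈ 𝔪 ^ n) : f = 0 := by
  ext e
  exact mem_pow_iff.mp (h (e.degree + 1)) e (Nat.lt_succ_self _)

theorem pow_anti {m n : ℕ} (h : m ≤ n) {f : FormalSeries} (hf : f ∈ 𝔪 ^ n) : f ∈ 𝔪 ^ m :=
  Ideal.pow_le_pow_right h hf

theorem mul_mem_pow {m n : ℕ} {f g : FormalSeries} (hf : f ∈ 𝔪 ^ m) (hg : g ∈ 𝔪 ^ n) :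
    f * g ∈ 𝔪 ^ (m + n) := by
  rw [pow_add]; exact Ideal.mul_mem_mul hf hg

theorem sub_constantCoeff_mem (f : FormalSeries) : f - C (constantCoeff f) ∈ 𝔪 := by
  rw [mem_maximalIdeal_iff, map_sub, constantCoeff_C, sub_self]

theorem algHom_C (σ : FormalSeries →ₐ[ℂ] FormalSeries) (c : ℂ) : σ (C c) = C c :=
  σ.commutes c

/-! ### Endomorphisms and derivations are controlled by the coordinates -/

/-- Every endomorphism of the algebra `ℂ⟦x, y₁, y₂⟧` is local. -/
theorem algHom_mem (σ : FormalSeries →ₐ[ℂ] FormalSeries) {f : FormalSeries} (hf : f ∈ 𝔪) :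
    σ f ∈ 𝔪 := by
  rw [mem_maximalIdeal_iff] at hf ⊢
  -- If `σ f` had a constant term c ≠ 0, the unit f - c would be sent to the non-unit σ f - c.
  by_contra hc
  have hu : IsUnit (f - C (constantCoeff (σ f))) := by
    rw [isUnit_iff_constantCoeff, map_sub, hf, constantCoeff_C, zero_sub, isUnit_iff_ne_zero]
    exact neg_ne_zero.mpr hc
  have h2 := hu.map σ
  rw [map_sub, algHom_C, isUnit_iff_constantCoeff, map_sub, constantCoeff_C, sub_self] at h2
  exact not_isUnit_zero h2

theorem algHom_mem_pow (σ : FormalSeries →ₐ[ℂ] FormalSeries) {n : ℕ} {f : FormalSeries}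
    (hf : f ∈ 𝔪 ^ n) : σ f ∈ 𝔪 ^ n := by
  have h1 : Ideal.map σ 𝔪 ≤ 𝔪 := Ideal.map_le_iff_le_comap.mpr fun g hg => algHom_mem σ hg
  have h2 := Ideal.pow_right_mono h1 n
  rw [← Ideal.map_pow] at h2
  exact h2 (Ideal.mem_map_of_mem σ hf)

/-- A linear operator `D` with `D (f g) = σ f · D g + τ g · D f`. Differences `σ - τ` of two algebra
homomorphisms and derivations along an algebra homomorphism are of this kind. -/
structure IsSkew (σ τ : FormalSeries →ₐ[ℂ] FormalSeries)
    (D : FormalSeries →ₗ[ℂ] FormalSeries) : Prop where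
  map_mul : ∀ f g, D (f * g) = σ f * D g + τ g * D f

namespace IsSkew

variable {σ τ : FormalSeries →ₐ[ℂ] FormalSeries} {D : FormalSeries →ₗ[ℂ] FormalSeries}

theorem map_C (h : IsSkew σ τ D) (c : ℂ) : D (C c) = 0 := by
  have h1 : D 1 = 0 := by
    have := h.map_mul 1 1
    rwa [mul_one, map_one σ, map_one τ, one_mul, left_eq_add] at this
  have h2 : (C c : FormalSeries) = c • 1 := by rw [smul_eq_C_mul, mul_one]
  rw [h2, map_smul, h1, smul_zero]

/-- The order is gained one unit at a time. Constants are killed, so `f` may be taken of the form ∑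
Xᵢ gᵢ; the factor σ Xᵢ ∈ 𝔪 then improves the order already known for D gᵢ, up to the order r of D
Xᵢ. -/
theorem map_mem (h : IsSkew σ τ D) {r : ℕ} (hX : ∀ i, D (X i) ∈ 𝔪 ^ r) (f : FormalSeries) :
    D f ∈ 𝔪 ^ r := by
  suffices H : ∀ m, m ≤ r → ∀ f, D f ∈ 𝔪 ^ m from H r le_rfl f
  intro m
  induction m with
  | zero => simp
  | succ m ih =>
    intro hm f
    obtain ⟨g, hg, -⟩ := exists_X_mul_of_mem_pow (n := 0)
      (by simpa using sub_constantCoeff_mem f)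
    have : D f = D (f - C (constantCoeff f)) := by rw [map_sub, h.map_C, sub_zero]
    rw [this, hg, map_sum]
    refine sum_mem fun i _ => ?_
    rw [h.map_mul]
    refine add_mem ?_ (Ideal.mul_mem_left _ _ (pow_anti hm (hX i)))
    rw [pow_succ']
    exact Ideal.mul_mem_mul (algHom_mem σ (X_mem i)) (ih (by omega) (g i))

/-- As σ and τ preserve the powers of 𝔪, the product rule raises the order by one for each factor in
𝔪 beyond the first. -/
theorem map_mem_add (h : IsSkew σ τ D) {r : ℕ} (hX : ∀ i, D (X i) ∈ 𝔪 ^ r) {k : ℕ}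
    {f : FormalSeries} (hf : f ∈ 𝔪 ^ (k + 1)) : D f ∈ 𝔪 ^ (r + k) := by
  induction k generalizing f with
  | zero => exact h.map_mem hX f
  | succ k ih =>
    rw [pow_succ] at hf
    refine Submodule.mul_induction_on hf (fun a ha b hb => ?_)
      (fun a b ha hb => by rw [map_add]; exact add_mem ha hb)
    rw [h.map_mul]
    refine add_mem ?_ ?_
    · rw [add_comm]
      exact mul_mem_pow (algHom_mem_pow σ ha) (h.map_mem hX b)
    · have := mul_mem_pow (algHom_mem_pow (n := 1) τ (by simpa using hb)) (ih ha)
      exact pow_anti (by omega) this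

theorem eq_zero (h : IsSkew σ τ D) (hX : ∀ i, D (X i) = 0) (f : FormalSeries) : D f = 0 :=
  eq_zero_of_forall_mem_pow fun n => h.map_mem (fun i => by rw [hX]; exact zero_mem _) f

end IsSkew

theorem isSkew_sub (σ τ : FormalSeries →ₐ[ℂ] FormalSeries) :
    IsSkew σ τ (σ.toLinearMap - τ.toLinearMap) where
  map_mul f g := by
    simp only [LinearMap.sub_apply, AlgHom.toLinearMap_apply, map_mul]
    ring

theorem isSkew_derivation (Y : VectorField) :
    IsSkew (AlgHom.id ℂ _) (AlgHom.id ℂ _) (Y : FormalSeries →ₗ[ℂ] FormalSeries) where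
  map_mul f g := by simp [Derivation.leibniz]

theorem isSkew_conj (Y Z : VectorField) (σ : FormalSeries →ₐ[ℂ] FormalSeries) :
    IsSkew σ σ ((Z : FormalSeries →ₗ[ℂ] FormalSeries) ∘ₗ σ.toLinearMap -
      σ.toLinearMap ∘ₗ (Y : FormalSeries →ₗ[ℂ] FormalSeries)) where
  map_mul f g := by
    simp [Derivation.leibniz]
    ring

theorem algHom_sub_mem (σ τ : FormalSeries →ₐ[ℂ] FormalSeries) {r k : ℕ}
    (hX : ∀ i, σ (X i) - τ (X i) ∈ 𝔪 ^ r) {f : FormalSeries} (hf : f ∈ 𝔪 ^ (k + 1)) :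
    σ f - τ f ∈ 𝔪 ^ (r + k) :=
  (isSkew_sub σ τ).map_mem_add hX hf

theorem algHom_ext {σ τ : FormalSeries →ₐ[ℂ] FormalSeries} (h : ∀ i, σ (X i) = τ (X i)) :
    σ = τ :=
  AlgHom.ext fun f => sub_eq_zero.mp <|
    (isSkew_sub σ τ).eq_zero (fun i => sub_eq_zero.mpr (h i)) f

theorem derivation_mem_add (Y : VectorField) {r k : ℕ} (hX : ∀ i, Y (X i) ∈ 𝔪 ^ r)
    {f : FormalSeries} (hf : f ∈ 𝔪 ^ (k + 1)) : Y f ∈ 𝔪 ^ (r + k) :=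
  (isSkew_derivation Y).map_mem_add hX hf

/-- Two vector fields are related by `σ` as soon as they are related on the coordinates. -/
theorem related_of_X {Y Z : VectorField} {σ : FormalSeries →ₐ[ℂ] FormalSeries}
    (h : ∀ i, Z (σ (X i)) = σ (Y (X i))) (f : FormalSeries) : Z (σ f) = σ (Y f) :=
  sub_eq_zero.mp <| (isSkew_conj Y Z σ).eq_zero (fun i => sub_eq_zero.mpr (h i)) f

theorem vectorField_ext {Y Z : VectorField} (h : ∀ i, Y (X i) = Z (X i)) : Y = Z :=
  Derivation.ext fun f => (related_of_X (σ := AlgHom.id ℂ _) (fun i => (h i).symm) f).symm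

/-! ### Fixed points of 𝔪-adic contractions -/

/-- Contractions of tuples of series with prescribed supports have fixed points. -/
theorem exists_fixedPoint {ι : Type*} (supp : ι → (Fin 3 →₀ ℕ) → Prop) (s : ι → ℕ) (n₀ : ℕ)
    (T : (ι → FormalSeries) → ι → FormalSeries)
    (hsupp : ∀ j e, supp j e → n₀ + s j ≤ e.degree)
    (hT : ∀ u, (∀ j e, ¬ supp j e → coeff e (u j) = 0) →
      ∀ j e, ¬ supp j e → coeff e (T u j) = 0)
    (hcontr : ∀ n, n₀ ≤ n → ∀ u u', (∀ j e, ¬ supp j e → coeff e (u j) = 0) →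
      (∀ j e, ¬ supp j e → coeff e (u' j) = 0) → (∀ j, u j - u' j ∈ 𝔪 ^ (n + s j)) →
      ∀ j, T u j - T u' j ∈ 𝔪 ^ (n + 1 + s j)) :
    ∃ u, (∀ j e, ¬ supp j e → coeff e (u j) = 0) ∧ T u = u := by
  set G : (ι → FormalSeries) → Prop := fun u => ∀ j e, ¬ supp j e → coeff e (u j) = 0 with hG
  have hit : ∀ k, G (T^[k] 0) := by
    intro k
    induction k with
    | zero => intro j e _; simp
    | succ k ih => rw [Function.iterate_succ_apply']; exact hT _ ih
  have base : ∀ u u', G u → G u' → ∀ j, u j - u' j ∈ 𝔪 ^ (n₀ + s j) := by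
    intro u u' hu hu' j
    rw [mem_pow_iff]
    intro e he
    have hne : ¬ supp j e := fun h => by have := hsupp j e h; omega
    rw [map_sub, hu j e hne, hu' j e hne, sub_self]
  have step : ∀ k j, T^[k + 1] 0 j - T^[k] 0 j ∈ 𝔪 ^ (n₀ + k + s j) := by
    intro k
    induction k with
    | zero => exact base _ _ (hit 1) (hit 0)
    | succ k ih =>
      intro j
      have := hcontr (n₀ + k) (by omega) _ _ (hit (k + 1)) (hit k) ih j
      rw [← Function.iterate_succ_apply' T (k + 1), ← Function.iterate_succ_apply' T k] at this
      exact pow_anti (by omega) this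
  have steps : ∀ k l j, T^[k + l] 0 j - T^[k] 0 j ∈ 𝔪 ^ (n₀ + k + s j) := by
    intro k l j
    induction l with
    | zero => simp
    | succ l ih =>
      have := add_mem (pow_anti (by omega) (step (k + l) j)) ih
      rwa [sub_add_sub_cancel] at this
  -- The iterates k and k + l agree below degree n₀ + k + s j, so a coefficient of degree d no
  -- longer changes from the iterate d + 1 on.
  set u : ι → FormalSeries := fun j e => coeff e (T^[e.degree + 1] 0 j) with hu
  have lim : ∀ k j, u j - T^[k] 0 j ∈ 𝔪 ^ (n₀ + k + s j) := by
    intro k j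
    rw [mem_pow_iff]
    intro e he
    rw [map_sub, sub_eq_zero]
    change coeff e (T^[e.degree + 1] 0 j) = _
    rcases le_total k (e.degree + 1) with h | h
    · obtain ⟨l, hl⟩ := Nat.exists_eq_add_of_le h
      have := mem_pow_iff.mp (steps k l j) e he
      rwa [map_sub, sub_eq_zero, ← hl] at this
    · obtain ⟨l, hl⟩ := Nat.exists_eq_add_of_le h
      have := mem_pow_iff.mp (steps (e.degree + 1) l j) e (by omega)
      rw [map_sub, sub_eq_zero, ← hl] at this
      exact this.symm
  have huG : G u := fun j e he => hit _ j e he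
  refine ⟨u, huG, ?_⟩
  funext j
  rw [← sub_eq_zero]
  refine eq_zero_of_forall_mem_pow fun k => ?_
  have h1 := hcontr (n₀ + k) (by omega) u (T^[k] 0) huG (hit k) (lim k) j
  have h2 := lim (k + 1) j
  rw [Function.iterate_succ_apply'] at h2
  have := sub_mem h1 h2
  rw [sub_sub_sub_cancel_right] at this
  exact pow_anti (by omega) this

/-- Endomorphisms tangent to the identity are bijective. -/
theorem algHom_bijective (σ : FormalSeries →ₐ[ℂ] FormalSeries)
    (h : ∀ i, σ (X i) - X i ∈ 𝔪 ^ 2) : Function.Bijective σ := by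
  have hk : ∀ n, ∀ f ∈ 𝔪 ^ n, σ f - f ∈ 𝔪 ^ (n + 1) := by
    intro n f hf
    cases n with
    | zero => exact pow_anti one_le_two ((isSkew_sub σ (AlgHom.id ℂ _)).map_mem h f)
    | succ n => exact pow_anti (by omega) (algHom_sub_mem σ (AlgHom.id ℂ _) h hf)
  constructor
  · rw [injective_iff_map_eq_zero]
    intro f hf
    refine eq_zero_of_forall_mem_pow fun n => ?_
    induction n with
    | zero => simp
    | succ n ih => simpa [hf] using hk n f ih
  · intro g
    -- A preimage of `g` is a fixed point of u ↦ g - (σ u - u), which contracts because σ - id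
    -- raises the order.
    obtain ⟨u, -, hu⟩ := exists_fixedPoint (ι := Unit) (fun _ _ => True) (fun _ => 0) 0
      (fun u _ => g - (σ (u ()) - u ())) (fun _ _ _ => Nat.zero_le _)
      (fun u _ j e h => absurd trivial h)
      (fun n _ u u' _ _ huu j => by
        have := neg_mem (hk n _ (huu ()))
        rw [map_sub] at this
        convert this using 1
        ring)
    refine ⟨u (), ?_⟩
    have := congrFun hu ()
    simp only [sub_eq_iff_eq_add] at this
    rw [this]; ring

/-! ### Fibered fields, their linear part, fibered endomorphisms -/

/-- The endomorphism of `ℂ⟦x, y₁, y₂⟧` with prescribed values on the coordinates. -/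
theorem exists_algHom (ψ : Fin 3 → FormalSeries) (h : ∀ i, ψ i ∈ 𝔪) :
    ∃ σ : FormalSeries →ₐ[ℂ] FormalSeries, ∀ i, σ (X i) = ψ i := by
  have hs : HasSubst ψ := hasSubst_of_constantCoeff_zero fun i => (mem_maximalIdeal_iff _).mp (h i)
  exact ⟨substAlgHom hs, substAlgHom_X hs⟩

/-- The vector field `x² ∂/∂x + b₁ ∂/∂y₁ + b₂ ∂/∂y₂`. -/
def fibered (b : Fin 2 → FormalSeries) : VectorField := ofComponents (x ^ 2) (b 0) (b 1)

/-- The eigenvalues `-λ, λ` of the linear part. -/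
def eigenvalue (lam : ℂ) : Fin 2 → ℂ := ![-lam, lam]

/-- The linear vector field `-λ y₁ ∂/∂y₁ + λ y₂ ∂/∂y₂`. -/
def linearField (lam : ℂ) : VectorField :=
  ofComponents 0 (C (eigenvalue lam 0) * X 1) (C (eigenvalue lam 1) * X 2)

theorem fibered_apply (b : Fin 2 → FormalSeries) (f : FormalSeries) :
    fibered b f = x ^ 2 * pderiv ℂ 0 f + b 0 * pderiv ℂ 1 f + b 1 * pderiv ℂ 2 f := rfl

theorem linearField_apply (lam : ℂ) (f : FormalSeries) :
    linearField lam f = C (eigenvalue lam 0) * X 1 * pderiv ℂ 1 f +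
      C (eigenvalue lam 1) * X 2 * pderiv ℂ 2 f := by
  simp [linearField, ofComponents]

theorem fibered_X_zero (b : Fin 2 → FormalSeries) : fibered b (X 0) = x ^ 2 := by
  simp [fibered_apply]

theorem fibered_X_succ (b : Fin 2 → FormalSeries) (i : Fin 2) :
    fibered b (X i.succ) = b i := by
  fin_cases i <;> simp [fibered_apply]

theorem linearField_X_zero (lam : ℂ) : linearField lam (X 0) = 0 := by
  simp [linearField_apply]

theorem linearField_X_succ (lam : ℂ) (i : Fin 2) :
    linearField lam (X i.succ) = C (eigenvalue lam i) * X i.succ := by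
  fin_cases i <;> simp [linearField_apply]

theorem coeff_X_mul_pderiv (i : Fin 3) (e : Fin 3 →₀ ℕ) (f : FormalSeries) :
    coeff e (X i * pderiv ℂ i f) = e i * coeff e f := by
  rw [coeff_X_mul_eq, coeff_pderiv]
  split_ifs with h
  · simp [h]
  · have h1 : single i 1 ≤ e := Finsupp.single_le_iff.mpr (Nat.one_le_iff_ne_zero.mpr h)
    rw [tsub_add_cancel_of_le h1, mul_comm]
    congr 1
    rw [Finsupp.tsub_apply, Finsupp.single_eq_same, ← Nat.cast_add_one,
      Nat.sub_add_cancel (Nat.one_le_iff_ne_zero.mpr h)]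

theorem coeff_linearField (lam : ℂ) (e : Fin 3 →₀ ℕ) (f : FormalSeries) :
    coeff e (linearField lam f) = lam * ((e 2 : ℂ) - e 1) * coeff e f := by
  rw [linearField_apply, mul_assoc, mul_assoc, map_add, coeff_C_mul, coeff_C_mul,
    coeff_X_mul_pderiv, coeff_X_mul_pderiv]
  simp only [eigenvalue, Matrix.cons_val_zero, Matrix.cons_val_one]
  ring

theorem linearField_mem_pow (lam : ℂ) {n : ℕ} {f : FormalSeries} (hf : f ∈ 𝔪 ^ n) :
    linearField lam f ∈ 𝔪 ^ n := by
  rw [mem_pow_iff] at hf ⊢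
  intro e he
  rw [coeff_linearField, hf e he, mul_zero]

theorem fibered_X_mem {b : Fin 2 → FormalSeries} {r : ℕ} (hr : r ≤ 2)
    (hb : ∀ i, b i ∈ 𝔪 ^ r) (i : Fin 3) : fibered b (X i) ∈ 𝔪 ^ r := by
  refine Fin.cases ?_ (fun i => ?_) i
  · rw [fibered_X_zero]
    exact pow_anti hr (Ideal.pow_mem_pow x_mem 2)
  · rw [fibered_X_succ]
    exact hb i

theorem fibered_mem {b : Fin 2 → FormalSeries} (hb : ∀ i, b i ∈ 𝔪 ^ 2) {k : ℕ} {f : FormalSeries}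
    (hf : f ∈ 𝔪 ^ (k + 1)) : fibered b f ∈ 𝔪 ^ (2 + k) :=
  derivation_mem_add _ (fibered_X_mem le_rfl hb) hf

theorem fibered_sub_mem {b b' : Fin 2 → FormalSeries} {n : ℕ} (hb : ∀ i, b i - b' i ∈ 𝔪 ^ n)
    {k : ℕ} {f : FormalSeries} (hf : f ∈ 𝔪 ^ (k + 1)) :
    fibered b f - fibered b' f ∈ 𝔪 ^ (n + k) := by
  refine derivation_mem_add (fibered b - fibered b') (fun i => ?_) hf
  refine Fin.cases ?_ (fun i => ?_) i
  · rw [Derivation.sub_apply, fibered_X_zero, fibered_X_zero, sub_self]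
    exact zero_mem _
  · rw [Derivation.sub_apply, fibered_X_succ, fibered_X_succ]
    exact hb i

/-- The term x² ∂/∂x is grouped with N: being of order two, it leaves `fibered N` order-raising
whenever N ∈ 𝔪². -/
theorem fibered_eigenvalue_add (lam : ℂ) (N : Fin 2 → FormalSeries) (f : FormalSeries) :
    fibered (fun i => C (eigenvalue lam i) * X i.succ + N i) f =
      linearField lam f + fibered N f := by
  rw [fibered_apply, fibered_apply, linearField_apply]
  simp only [Fin.succ_zero_eq_one, Fin.succ_one_eq_two]
  ring

/-- The linear operator multiplying the coefficient of each monomial by a given scalar. -/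
def diagonal (w : (Fin 3 →₀ ℕ) → ℂ) : FormalSeries →ₗ[ℂ] FormalSeries where
  toFun f := fun e => w e * coeff e f
  map_add' f g := by ext e; exact mul_add _ _ _
  map_smul' c f := by ext e; exact mul_left_comm _ _ _

theorem coeff_diagonal (w : (Fin 3 →₀ ℕ) → ℂ) (e : Fin 3 →₀ ℕ) (f : FormalSeries) :
    coeff e (diagonal w f) = w e * coeff e f := rfl

theorem diagonal_mem_pow (w : (Fin 3 →₀ ℕ) → ℂ) {n : ℕ} {f : FormalSeries} (hf : f ∈ 𝔪 ^ n) :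
    diagonal w f ∈ 𝔪 ^ n := by
  rw [mem_pow_iff] at hf ⊢
  intro e he
  rw [coeff_diagonal, hf e he, mul_zero]

/-- The endomorphism `f ↦ f(x, g₁, g₂)` (for `g₁, g₂ ∈ 𝔪`). -/
def fiberedHom (g : Fin 2 → FormalSeries) : FormalSeries →ₐ[ℂ] FormalSeries :=
  -- The default value makes the map total in `g`: `exists_fixedPoint` iterates a map defined on all
  -- tuples, including those whose values are not in 𝔪.
  open Classical in
  if h : ∀ i, (Fin.cons x g : Fin 3 → FormalSeries) i ∈ 𝔪 then (exists_algHom _ h).choose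
  else AlgHom.id ℂ _

theorem fiberedHom_X {g : Fin 2 → FormalSeries} (hg : ∀ i, g i ∈ 𝔪) (i : Fin 3) :
    fiberedHom g (X i) = (Fin.cons x g : Fin 3 → FormalSeries) i := by
  have h : ∀ i, (Fin.cons x g : Fin 3 → FormalSeries) i ∈ 𝔪 := Fin.cases x_mem hg
  rw [fiberedHom, dif_pos h]
  exact (exists_algHom _ h).choose_spec i

theorem fiberedHom_X_zero {g : Fin 2 → FormalSeries} (hg : ∀ i, g i ∈ 𝔪) :
    fiberedHom g (X 0) = X 0 := fiberedHom_X hg 0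

theorem fiberedHom_X_succ {g : Fin 2 → FormalSeries} (hg : ∀ i, g i ∈ 𝔪) (i : Fin 2) :
    fiberedHom g (X i.succ) = g i := fiberedHom_X hg i.succ

theorem fiberedHom_sub_mem {g g' : Fin 2 → FormalSeries} (hg : ∀ i, g i ∈ 𝔪)
    (hg' : ∀ i, g' i ∈ 𝔪) {n k : ℕ} (h : ∀ i, g i - g' i ∈ 𝔪 ^ n) {f : FormalSeries}
    (hf : f ∈ 𝔪 ^ (k + 1)) : fiberedHom g f - fiberedHom g' f ∈ 𝔪 ^ (n + k) := by
  refine algHom_sub_mem _ _ (fun i => ?_) hf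
  refine Fin.cases ?_ (fun i => ?_) i
  · rw [fiberedHom_X_zero hg, fiberedHom_X_zero hg', sub_self]
    exact zero_mem _
  · rw [fiberedHom_X_succ hg, fiberedHom_X_succ hg']
    exact h i

/-- A bijective endomorphism fixing `x` that relates `Y` and `Z` conjugates them. -/
theorem exists_smul_eq_of_related {Y Z : VectorField} {σ : FormalSeries →ₐ[ℂ] FormalSeries}
    (hσ : Function.Bijective σ) (h0 : σ (X 0) = X 0) (hx : Y (X 0) = x ^ 2) (hx' : Z (X 0) = x ^ 2)
    (h : ∀ i : Fin 2, Z (σ (X i.succ)) = σ (Y (X i.succ))) :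
    ∃ Φ : FiberedDiffeo, Φ • Y = Z := by
  have hf : ∀ f, Z (σ f) = σ (Y f) := related_of_X fun i => by
    refine Fin.cases ?_ h i
    rw [h0, hx, hx', map_pow]
    exact (congrArg (· ^ 2) h0).symm
  let e := AlgEquiv.ofBijective σ hσ
  -- Since Φ • Y = (Φ^*)⁻¹ ∘ Y ∘ Φ^*, the map σ has to be (Φ^*)⁻¹.
  refine ⟨⟨MulOpposite.op e.symm, ?_⟩, ?_⟩
  · change e.symm x = x
    rw [AlgEquiv.symm_apply_eq]
    exact h0.symm
  · refine Derivation.ext fun f => ?_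
    change e (Y (e.symm f)) = Z f
    have := hf (e.symm f)
    rw [show σ (e.symm f) = f from e.apply_symm_apply f] at this
    exact this.symm

/-! ### Elimination of the non-resonant terms -/

/-- A vector field with linear part `-λ y₁ ∂/∂y₁ + λ y₂ ∂/∂y₂` is conjugate to one with only
resonant terms. -/
theorem exists_smul_eq_resonant {lam : ℂ} {F : Fin 2 → FormalSeries} (hF : ∀ i, F i ∈ 𝔪 ^ 2) :
    ∃ N : Fin 2 → FormalSeries, (∀ i, N i ∈ 𝔪 ^ 2) ∧
      (∀ i, linearField lam (N i) = C (eigenvalue lam i) * N i) ∧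
      (∀ i, coeff (single 0 1 + single i.succ 1) (N i) =
        coeff (single 0 1 + single i.succ 1) (F i)) ∧
      ∃ Φ : FiberedDiffeo,
        Φ • fibered (fun i => C (eigenvalue lam i) * X i.succ + F i) =
          fibered (fun i => C (eigenvalue lam i) * X i.succ + N i) := by
  classical
  set wt : (Fin 3 →₀ ℕ) → ℂ := fun e => lam * ((e 2 : ℂ) - e 1) with hwt
  -- With μᵢ the eigenvalue of yᵢ, `P` projects onto the kernel of S - μᵢ and `Q` inverts S - μᵢ off
  -- this kernel; since 0⁻¹ = 0, `Q` kills the resonant monomials.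
  set P : Fin 2 → (Fin 3 →₀ ℕ) → ℂ := fun i e => if wt e = eigenvalue lam i then 1 else 0 with hP
  set Q : Fin 2 → (Fin 3 →₀ ℕ) → ℂ := fun i e => (wt e - eigenvalue lam i)⁻¹ with hQ
  set ψ : (Fin 2 ⊕ Fin 2 → FormalSeries) → Fin 2 → FormalSeries :=
    fun u i => X i.succ + u (Sum.inl i) with hψ
  -- For σ yᵢ = yᵢ + hᵢ (`Sum.inl`) and target terms Nᵢ (`Sum.inr`), the conjugacy equation reads (S
  -- - μᵢ) hᵢ + Nᵢ = Fᵢ(x, y + h) - N(hᵢ), where N also contains x² ∂/∂x. `R` is the right-hand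
  -- side, and its parts under `Q` and `P` have to be hᵢ and Nᵢ.
  set R : (Fin 2 ⊕ Fin 2 → FormalSeries) → Fin 2 → FormalSeries := fun u i =>
    fiberedHom (ψ u) (F i) - fibered (fun j => u (Sum.inr j)) (u (Sum.inl i)) with hR
  set supp : Fin 2 ⊕ Fin 2 → (Fin 3 →₀ ℕ) → Prop :=
    Sum.elim (fun _ e => 2 ≤ e.degree) (fun i e => 2 ≤ e.degree ∧ wt e = eigenvalue lam i)
    with hs
  have hm : ∀ u : Fin 2 ⊕ Fin 2 → FormalSeries, (∀ j e, ¬ supp j e → coeff e (u j) = 0) →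
      ∀ j, u j ∈ 𝔪 ^ 2 := by
    rintro u hu (i | i)
    · exact mem_pow_iff.mpr fun e he => hu _ e (not_le.mpr he)
    · exact mem_pow_iff.mpr fun e he => hu _ e fun h => not_le.mpr he h.1
  have hψm : ∀ u : Fin 2 ⊕ Fin 2 → FormalSeries, (∀ j, u j ∈ 𝔪 ^ 2) → ∀ i, ψ u i ∈ 𝔪 :=
    fun u hu i => add_mem (X_mem _) (Ideal.pow_le_self two_ne_zero (hu _))
  have hRm : ∀ u : Fin 2 ⊕ Fin 2 → FormalSeries, (∀ j, u j ∈ 𝔪 ^ 2) → ∀ i, R u i ∈ 𝔪 ^ 2 :=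
    fun u hu i => sub_mem (algHom_mem_pow _ (hF i))
      (pow_anti (by norm_num) (fibered_mem (fun j => hu (Sum.inr j)) (k := 1) (hu (Sum.inl i))))
  obtain ⟨u, hu, hfix⟩ := exists_fixedPoint supp (fun _ => 0) 2
    (fun u => Sum.elim (fun i => diagonal (Q i) (R u i)) (fun i => diagonal (P i) (R u i)))
    (by rintro (i | i) e he
        · exact he
        · exact he.1)
    (by
      rintro u hu (i | i) e he
      · exact mem_pow_iff.mp (diagonal_mem_pow _ (hRm u (hm u hu) i)) e (not_le.mp he)
      · rw [Sum.elim_inr, coeff_diagonal]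
        by_cases h : wt e = eigenvalue lam i
        · rw [mem_pow_iff.mp (hRm u (hm u hu) i) e (not_le.mp fun h' => he ⟨h', h⟩), mul_zero]
        · simp only [hP, if_neg h, zero_mul])
    (by
      intro n hn u u' hu hu' huu
      have hu2 := hm u hu
      have hu2' := hm u' hu'
      -- One order is gained in each term, because Fᵢ and the components of the field N lie in 𝔪².
      have key : ∀ i, R u i - R u' i ∈ 𝔪 ^ (n + 1) := by
        intro i
        have h1 := fiberedHom_sub_mem (hψm u hu2) (hψm u' hu2') (n := n) (k := 1)
          (fun i => by simpa [hψ] using huu (Sum.inl i)) (hF i)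
        have h2 := fibered_sub_mem (b := fun j => u (Sum.inr j)) (b' := fun j => u' (Sum.inr j))
          (n := n) (k := 1) (fun j => by simpa using huu (Sum.inr j)) (hu2 (Sum.inl i))
        have h3 : fibered (fun j => u' (Sum.inr j)) (u (Sum.inl i) - u' (Sum.inl i)) ∈
            𝔪 ^ (n + 1) := by
          refine pow_anti (by omega)
            (fibered_mem (fun j => hu2' (Sum.inr j)) (k := n - 1) (f := _) ?_)
          rw [Nat.sub_add_cancel (by omega)]
          simpa using huu (Sum.inl i)
        have := sub_mem (sub_mem h1 h2) h3
        rw [map_sub] at this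
        convert this using 1
        simp only [hR]
        ring
      rintro (i | i)
      · simp only [Sum.elim_inl, add_zero]
        rw [← map_sub]
        exact diagonal_mem_pow _ (key i)
      · simp only [Sum.elim_inr, add_zero]
        rw [← map_sub]
        exact diagonal_mem_pow _ (key i))
  have hu2 := hm u hu
  have hh : ∀ i, diagonal (Q i) (R u i) = u (Sum.inl i) := fun i => congrFun hfix (Sum.inl i)
  have hN : ∀ i, diagonal (P i) (R u i) = u (Sum.inr i) := fun i => congrFun hfix (Sum.inr i)
  have hlin : ∀ i, linearField lam (u (Sum.inl i)) - C (eigenvalue lam i) * u (Sum.inl i) +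
      u (Sum.inr i) = R u i := by
    intro i
    ext e
    rw [map_add, map_sub, coeff_linearField, coeff_C_mul, ← hh, ← hN, coeff_diagonal,
      coeff_diagonal]
    change wt e * _ - _ + _ = _
    by_cases h : wt e = eigenvalue lam i
    · simp [hP, hQ, h]
    · have h' := sub_ne_zero.mpr h
      simp only [hP, hQ, if_neg h]
      field_simp
      ring
  have hψ2 : ∀ i, fiberedHom (ψ u) (X i) - X i ∈ 𝔪 ^ 2 := by
    intro i
    refine Fin.cases ?_ (fun i => ?_) i
    · rw [fiberedHom_X_zero (hψm u hu2), sub_self]; exact zero_mem _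
    · rw [fiberedHom_X_succ (hψm u hu2), add_sub_cancel_left]; exact hu2 _
  refine ⟨fun i => u (Sum.inr i), fun i => hu2 _, fun i => ?_, fun i => ?_, ?_⟩
  · ext e
    rw [coeff_linearField, coeff_C_mul]
    by_cases h : wt e = eigenvalue lam i
    · rw [← h]
    · rw [hu (Sum.inr i) e (fun h' => h h'.2), mul_zero, mul_zero]
  -- The monomial x yᵢ is resonant, and R - Fᵢ ∈ 𝔪³ cannot affect its coefficient; this preserves
  -- the residue.
  · have hw : wt (single 0 1 + single i.succ 1) = eigenvalue lam i := by
      fin_cases i <;> simp [hwt, eigenvalue]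
    have h1 : fiberedHom (ψ u) (F i) - F i ∈ 𝔪 ^ (2 + 1) := by
      refine algHom_sub_mem _ (AlgHom.id ℂ _) (fun i => ?_) (k := 1) (hF i)
      exact hψ2 i
    have h2 := fibered_mem (fun j => hu2 (Sum.inr j)) (k := 1) (hu2 (Sum.inl i))
    have h3 := mem_pow_iff.mp (sub_mem h1 h2) (single 0 1 + single i.succ 1)
      (by rw [map_add, Finsupp.degree_single, Finsupp.degree_single]; norm_num)
    change coeff _ (u (Sum.inr i)) = _
    rw [← hN, coeff_diagonal]
    simp only [hP, if_pos hw, one_mul]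
    rw [← sub_eq_zero, ← map_sub, ← h3]
    congr 1
    simp only [hR]
    ring
  · refine exists_smul_eq_of_related (σ := fiberedHom (ψ u)) (algHom_bijective _ hψ2) (fiberedHom_X_zero (hψm u hu2))
      (fibered_X_zero _) (fibered_X_zero _) fun i => ?_
    rw [fibered_X_succ, map_add, map_mul, algHom_C, fiberedHom_X_succ (hψm u hu2)]
    have := hlin i
    simp only [hR] at this
    rw [fibered_eigenvalue_add]
    simp only [hψ, map_add]
    rw [linearField_X_succ, fibered_X_succ]
    linear_combination this

/-! ### Resonant series -/

/-- Resonant series: those in which `y₁` and `y₂` only occur through `y₁ y₂`. -/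
def IsResonant (f : FormalSeries) : Prop := linearField 1 f = 0

/-- The kernel of a derivation is stable under products; this coefficient form complements it with
stability under operators diagonal on monomials. -/
theorem isResonant_iff {f : FormalSeries} :
    IsResonant f ↔ ∀ e : Fin 3 →₀ ℕ, e 1 ≠ e 2 → coeff e f = 0 := by
  constructor
  · intro h e he
    have h1 : coeff e (linearField 1 f) = 0 := by rw [show linearField 1 f = 0 from h, map_zero]
    rw [coeff_linearField, one_mul] at h1
    refine (mul_eq_zero.mp h1).resolve_left (sub_ne_zero.mpr ?_)
    exact_mod_cast he.symm
  · intro h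
    refine MvPowerSeries.ext fun e => ?_
    rw [coeff_linearField, map_zero]
    by_cases he : e 1 = e 2
    · rw [he, sub_self, mul_zero, zero_mul]
    · rw [h e he, mul_zero]

theorem IsResonant.linearField_eq_zero {f : FormalSeries} (hf : IsResonant f) (lam : ℂ) :
    linearField lam f = 0 := by
  refine MvPowerSeries.ext fun e => ?_
  rw [coeff_linearField, map_zero]
  by_cases he : e 1 = e 2
  · rw [he, sub_self, mul_zero, zero_mul]
  · rw [isResonant_iff.mp hf e he, mul_zero]

theorem IsResonant.add {f g : FormalSeries} (hf : IsResonant f) (hg : IsResonant g) :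
    IsResonant (f + g) := by
  rw [IsResonant, map_add, show linearField 1 f = 0 from hf, show linearField 1 g = 0 from hg,
    add_zero]

theorem IsResonant.sub {f g : FormalSeries} (hf : IsResonant f) (hg : IsResonant g) :
    IsResonant (f - g) := by
  rw [IsResonant, map_sub, show linearField 1 f = 0 from hf, show linearField 1 g = 0 from hg,
    sub_zero]

theorem IsResonant.mul {f g : FormalSeries} (hf : IsResonant f) (hg : IsResonant g) :
    IsResonant (f * g) := by
  rw [IsResonant, Derivation.leibniz, show linearField 1 f = 0 from hf,
    show linearField 1 g = 0 from hg, smul_zero, smul_zero, add_zero]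

theorem isResonant_C (c : ℂ) : IsResonant (C c) := by
  rw [IsResonant, linearField_apply]
  simp

theorem isResonant_x : IsResonant x := linearField_X_zero 1

/-- The Euler operator `y₁ ∂/∂y₁`. -/
def euler (f : FormalSeries) : FormalSeries := X 1 * pderiv ℂ 1 f

theorem coeff_euler (e : Fin 3 →₀ ℕ) (f : FormalSeries) :
    coeff e (euler f) = e 1 * coeff e f := coeff_X_mul_pderiv 1 e f

theorem euler_sub (f g : FormalSeries) : euler (f - g) = euler f - euler g := by
  rw [euler, map_sub, mul_sub]; rfl

theorem euler_mem_pow {n : ℕ} {f : FormalSeries} (hf : f ∈ 𝔪 ^ n) : euler f ∈ 𝔪 ^ n := by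
  rw [mem_pow_iff] at hf ⊢
  intro e he
  rw [coeff_euler, hf e he, mul_zero]

theorem IsResonant.euler {f : FormalSeries} (hf : IsResonant f) : IsResonant (euler f) := by
  rw [isResonant_iff] at hf ⊢
  intro e he
  rw [coeff_euler, hf e he, mul_zero]

/-- On a series in x and v, y₁ ∂/∂y₁ and y₂ ∂/∂y₂ coincide, so only the sum K₀ + K₁ acts. This is
why a₁ + a₂ alone governs non-degeneracy. -/
theorem fibered_of_isResonant (K : Fin 2 → FormalSeries) {f : FormalSeries} (hf : IsResonant f) :
    fibered (fun i => K i * X i.succ) f = x * (X 0 * pderiv ℂ 0 f) + (K 0 + K 1) * euler f := by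
  have h2 : X 2 * pderiv ℂ 2 f = euler f := by
    ext e
    rw [coeff_X_mul_pderiv, coeff_euler]
    by_cases he : e 1 = e 2
    · rw [he]
    · rw [isResonant_iff.mp hf e he, mul_zero, mul_zero]
  rw [fibered_apply, add_mul]
  nth_rw 2 [← h2]
  rw [euler, x]
  simp only [Fin.succ_zero_eq_one, Fin.succ_one_eq_two]
  ring

theorem coeff_x_mul (e : Fin 3 →₀ ℕ) (f : FormalSeries) :
    coeff (e + single 0 1) (x * f) = coeff e f := by
  rw [x, coeff_X_mul_eq, add_tsub_cancel_right, if_neg (by simp)]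

theorem coeff_x_mul_of_eq_zero {e : Fin 3 →₀ ℕ} (he : e 0 = 0) (f : FormalSeries) :
    coeff e (x * f) = 0 := by
  rw [x, coeff_X_mul_eq, if_pos he]

/-- Action of `x² ∂/∂x + a x y₁ ∂/∂y₁` on coefficients. -/
theorem coeff_x_mul_euler (a : ℂ) (e : Fin 3 →₀ ℕ) (f : FormalSeries) :
    coeff (e + single 0 1) (x * (X 0 * pderiv ℂ 0 f) + C a * x * euler f) =
      (e 0 + a * e 1) * coeff e f := by
  rw [map_add, coeff_x_mul, mul_assoc, coeff_C_mul, coeff_x_mul, coeff_X_mul_pderiv, coeff_euler]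
  ring

theorem X_mul_mem_pow_iff {i : Fin 3} {n : ℕ} {f : FormalSeries} :
    X i * f ∈ 𝔪 ^ (n + 1) ↔ f ∈ 𝔪 ^ n := by
  constructor
  · rw [mem_pow_iff, mem_pow_iff]
    intro h e he
    have := h (e + single i 1) (by rw [map_add, Finsupp.degree_single]; omega)
    rwa [coeff_X_mul_eq, add_tsub_cancel_right, if_neg (by simp)] at this
  · intro h
    rw [pow_succ']
    exact Ideal.mul_mem_mul (X_mem i) h

theorem X_mul_cancel {i : Fin 3} {f g : FormalSeries}
    (h : (X i : FormalSeries) * f = X i * g) : f = g := by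
  ext e
  have := congrArg (coeff (e + single i 1)) h
  simpa [coeff_X_mul_eq] using this

/-- Eigenvectors of the linear part for the eigenvalue of `yᵢ` are resonant multiples of `yᵢ`. -/
theorem exists_isResonant_mul {lam : ℂ} (hlam : lam ≠ 0) {i : Fin 2} {f : FormalSeries}
    (hf : linearField lam f = C (eigenvalue lam i) * f) :
    ∃ A, IsResonant A ∧ f = A * X i.succ := by
  have hc : ∀ e : Fin 3 →₀ ℕ, ¬ ((e 2 : ℂ) - e 1 = eigenvalue 1 i) → coeff e f = 0 := by
    intro e he
    have h1 := congrArg (coeff e) hf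
    rw [coeff_linearField, coeff_C_mul, ← sub_eq_zero, ← sub_mul] at h1
    refine (mul_eq_zero.mp h1).resolve_left fun h2 => he ?_
    have h3 : eigenvalue lam i = lam * eigenvalue 1 i := by
      fin_cases i <;> simp [eigenvalue]
    rw [h3, ← mul_sub] at h2
    exact sub_eq_zero.mp ((mul_eq_zero.mp h2).resolve_left hlam)
  -- Weight -1 means e 1 = e 2 + 1 and weight 1 means e 2 = e 1 + 1, so the exponent of yᵢ is
  -- positive.
  obtain ⟨A, rfl⟩ : (X i.succ : FormalSeries) ∣ f := by
    rw [X_dvd_iff]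
    intro e he
    refine hc e fun h => ?_
    fin_cases i
    · change e 1 = 0 at he
      change (e 2 : ℂ) - e 1 = -1 at h
      rw [he, Nat.cast_zero, sub_zero, eq_neg_iff_add_eq_zero] at h
      exact absurd h (by exact_mod_cast Nat.succ_ne_zero (e 2))
    · change e 2 = 0 at he
      change (e 2 : ℂ) - e 1 = 1 at h
      rw [he, Nat.cast_zero, zero_sub, neg_eq_iff_add_eq_zero] at h
      exact absurd h (by exact_mod_cast Nat.succ_ne_zero (e 1))
  refine ⟨A, isResonant_iff.mpr fun e he => ?_, mul_comm _ _⟩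
  have := hc (e + single i.succ 1) fun h => he ?_
  · rwa [coeff_X_mul_eq, add_tsub_cancel_right, if_neg (by simp)] at this
  · fin_cases i
    · change ((e + single 1 1 : Fin 3 →₀ ℕ) 2 : ℂ) - (e + single 1 1 : Fin 3 →₀ ℕ) 1 = -1 at h
      simp only [Finsupp.add_apply, Finsupp.single_eq_same] at h
      rw [Finsupp.single_eq_of_ne (by decide)] at h
      push_cast at h
      have : (e 1 : ℂ) = e 2 := by linear_combination -h
      exact_mod_cast this
    · change ((e + single 2 1 : Fin 3 →₀ ℕ) 2 : ℂ) - (e + single 2 1 : Fin 3 →₀ ℕ) 1 = 1 at h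
      simp only [Finsupp.add_apply, Finsupp.single_eq_same] at h
      rw [Finsupp.single_eq_of_ne (by decide)] at h
      push_cast at h
      have : (e 1 : ℂ) = e 2 := by linear_combination -h
      exact_mod_cast this

/-- The scalars by which the normal form acts do not vanish in the non-degenerate case. -/
theorem add_mul_ne_zero {a : ℂ} (ha : ¬ IsNonposRat a) {k m : ℕ} (h : k ≠ 0 ∨ m ≠ 0) :
    (k : ℂ) + a * m ≠ 0 := by
  intro h0
  by_cases hm : m = 0
  · subst hm
    simp only [Nat.cast_zero, mul_zero, add_zero, Nat.cast_eq_zero] at h0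
    exact h.elim (fun h => h h0) (fun h => h rfl)
  · refine ha ⟨-(k / m), neg_nonpos.mpr (by positivity), ?_⟩
    have hm' : (m : ℂ) ≠ 0 := Nat.cast_ne_zero.mpr hm
    push_cast
    field_simp
    linear_combination h0

/-- The substitution yᵢ ↦ gᵢ yᵢ with resonant gᵢ commutes with the derivation `linearField 1`, hence
preserves its kernel. -/
theorem isResonant_fiberedHom {g : Fin 2 → FormalSeries} (hg : ∀ i, IsResonant (g i))
    {f : FormalSeries} (hf : IsResonant f) :
    IsResonant (fiberedHom (fun i => g i * X i.succ) f) := by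
  have hm : ∀ i : Fin 2, g i * X i.succ ∈ 𝔪 := fun i => Ideal.mul_mem_left _ _ (X_mem _)
  have := related_of_X (Y := linearField 1) (Z := linearField 1)
    (σ := fiberedHom (fun i => g i * X i.succ)) (fun i => by
      refine Fin.cases ?_ (fun i => ?_) i
      · rw [fiberedHom_X_zero hm, linearField_X_zero, map_zero]
      · rw [fiberedHom_X_succ hm, linearField_X_succ, map_mul (fiberedHom _), algHom_C, fiberedHom_X_succ hm,
          Derivation.leibniz, linearField_X_succ, show linearField 1 (g i) = 0 from hg i,
          smul_zero, add_zero, smul_eq_mul]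
        ring) f
  rw [IsResonant, this, show linearField 1 f = 0 from hf, map_zero]

/-- Coefficientwise solution of `(x² ∂/∂x + a x y₁ ∂/∂y₁) u = f` among resonant series. -/
def solveResonant (a : ℂ) (f : FormalSeries) : FormalSeries := fun e =>
  -- The shift reflects that the operator raises the x-degree by one. At e = 0 the denominator
  -- vanishes and the quotient is 0 by convention.
  if e 1 = e 2 then coeff (e + single 0 1) f / (e 0 + a * e 1) else 0

theorem coeff_solveResonant (a : ℂ) (f : FormalSeries) (e : Fin 3 →₀ ℕ) :
    coeff e (solveResonant a f) =
      if e 1 = e 2 then coeff (e + single 0 1) f / (e 0 + a * e 1) else 0 := rfl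

theorem solveResonant_sub (a : ℂ) (f g : FormalSeries) :
    solveResonant a (f - g) = solveResonant a f - solveResonant a g := by
  ext e
  rw [map_sub, coeff_solveResonant, coeff_solveResonant, coeff_solveResonant]
  split_ifs
  · rw [map_sub, sub_div]
  · rw [sub_zero]

theorem solveResonant_mem_pow (a : ℂ) {n : ℕ} {f : FormalSeries} (hf : f ∈ 𝔪 ^ (n + 1)) :
    solveResonant a f ∈ 𝔪 ^ n := by
  rw [mem_pow_iff] at hf ⊢
  intro e he
  rw [coeff_solveResonant, hf _ (by rw [map_add, Finsupp.degree_single]; omega), zero_div, ite_self]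

/-! ### Elimination of the dependence on x -/

/-- A resonant vector field is conjugate to one where the only remaining terms besides the residues
do not depend on `x`. -/
theorem exists_smul_eq_normal {lam : ℂ} {a : Fin 2 → ℂ} (ha : ¬ IsNonposRat (a 0 + a 1))
    {B : Fin 2 → FormalSeries} (hB : ∀ i, B i ∈ 𝔪 ^ 2) (hres : ∀ i, IsResonant (B i)) :
    ∃ c : Fin 2 → FormalSeries,
      (∀ i, ∀ e : Fin 3 →₀ ℕ, ¬ (e ≠ 0 ∧ e 1 = e 2 ∧ e 0 = 0) → coeff e (c i) = 0) ∧
      ∃ Φ : FiberedDiffeo,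
        Φ • fibered (fun i => (C (eigenvalue lam i) + C (a i) * x + B i) * X i.succ) =
          fibered (fun i => (C (eigenvalue lam i) + C (a i) * x + c i) * X i.succ) := by
  classical
  set ψ : (Fin 2 ⊕ Fin 2 → FormalSeries) → Fin 2 → FormalSeries :=
    fun u i => (1 + u (Sum.inl i)) * X i.succ with hψ
  -- For σ yᵢ = (1 + Uᵢ) yᵢ, division of the conjugacy equation by yᵢ gives cᵢ + L Uᵢ = (Bᵢ ∘ σ)(1 +
  -- Uᵢ) - cᵢ Uᵢ - (c₁ + c₂) y₁ ∂Uᵢ/∂y₁, where L = x² ∂/∂x + (a₁ + a₂) x y₁ ∂/∂y₁. The terms free of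
  -- x determine cᵢ, the others Uᵢ.
  set R : (Fin 2 ⊕ Fin 2 → FormalSeries) → Fin 2 → FormalSeries := fun u i =>
    fiberedHom (ψ u) (B i) * (1 + u (Sum.inl i)) - u (Sum.inr i) * u (Sum.inl i) -
      (u (Sum.inr 0) + u (Sum.inr 1)) * euler (u (Sum.inl i)) with hR
  set w : (Fin 3 →₀ ℕ) → ℂ := fun e => if e 1 = e 2 ∧ e 0 = 0 then 1 else 0 with hw
  set supp : Fin 2 ⊕ Fin 2 → (Fin 3 →₀ ℕ) → Prop :=
    Sum.elim (fun _ e => 1 ≤ e.degree ∧ e 1 = e 2)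
      (fun i e => 2 ≤ e.degree ∧ e 1 = e 2 ∧ e 0 = 0) with hs
  have hU : ∀ u : Fin 2 ⊕ Fin 2 → FormalSeries, (∀ j e, ¬ supp j e → coeff e (u j) = 0) →
      ∀ i, u (Sum.inl i) ∈ 𝔪 ^ 1 := fun u hu i =>
    mem_pow_iff.mpr fun e he => hu _ e fun h => not_le.mpr he h.1
  have hc : ∀ u : Fin 2 ⊕ Fin 2 → FormalSeries, (∀ j e, ¬ supp j e → coeff e (u j) = 0) →
      ∀ i, u (Sum.inr i) ∈ 𝔪 ^ 2 := fun u hu i =>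
    mem_pow_iff.mpr fun e he => hu _ e fun h => not_le.mpr he h.1
  have hψm : ∀ u : Fin 2 ⊕ Fin 2 → FormalSeries, ∀ i, ψ u i ∈ 𝔪 :=
    fun u i => Ideal.mul_mem_left _ _ (X_mem _)
  have hRm : ∀ u : Fin 2 ⊕ Fin 2 → FormalSeries, (∀ j e, ¬ supp j e → coeff e (u j) = 0) →
      ∀ i, R u i ∈ 𝔪 ^ 2 := fun u hu i =>
    sub_mem (sub_mem (Ideal.mul_mem_right _ _ (algHom_mem_pow _ (hB i)))
      (Ideal.mul_mem_right _ _ (hc u hu i)))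
      (Ideal.mul_mem_right _ _ (add_mem (hc u hu 0) (hc u hu 1)))
  -- Inverting L costs one degree, so cᵢ is measured one degree higher than Uᵢ; the contraction
  -- holds because `R` gains two orders relative to Uᵢ.
  obtain ⟨u, hu, hfix⟩ := exists_fixedPoint supp (Sum.elim (fun _ => 0) (fun _ => 1)) 1
    (fun u => Sum.elim (fun i => solveResonant (a 0 + a 1) (R u i)) (fun i => diagonal w (R u i)))
    (by rintro (i | i) e he <;> exact he.1)
    (by
      rintro u hu (i | i) e he
      · rw [Sum.elim_inl, coeff_solveResonant]
        split_ifs with h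
        · have hd : e.degree < 1 := not_le.mp fun h' => he ⟨h', h⟩
          rw [mem_pow_iff.mp (hRm u hu i) _ (by rw [map_add, Finsupp.degree_single]; omega),
            zero_div]
        · rfl
      · rw [Sum.elim_inr, coeff_diagonal]
        by_cases h : e 1 = e 2 ∧ e 0 = 0
        · rw [mem_pow_iff.mp (hRm u hu i) e (not_le.mp fun h' => he ⟨h', h⟩), mul_zero]
        · simp only [hw, if_neg h, zero_mul])
    (by
      intro n hn u u' hu hu' huu
      have key : ∀ i, R u i - R u' i ∈ 𝔪 ^ (n + 2) := by
        intro i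
        have hUU : ∀ i, u (Sum.inl i) - u' (Sum.inl i) ∈ 𝔪 ^ n := fun i => huu (Sum.inl i)
        have hcc : ∀ i, u (Sum.inr i) - u' (Sum.inr i) ∈ 𝔪 ^ (n + 1) := fun i => huu (Sum.inr i)
        have h1 : fiberedHom (ψ u) (B i) - fiberedHom (ψ u') (B i) ∈ 𝔪 ^ (n + 2) :=
          fiberedHom_sub_mem (hψm u) (hψm u') (n := n + 1) (k := 1) (fun i => by
            have := (X_mul_mem_pow_iff (i := i.succ)).mpr (hUU i)
            convert this using 1
            simp only [hψ]
            ring) (hB i)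
        have h2 : (u (Sum.inl i) - u' (Sum.inl i)) * fiberedHom (ψ u') (B i) ∈ 𝔪 ^ (n + 2) :=
          mul_mem_pow (hUU i) (algHom_mem_pow _ (hB i))
        have h3 : (u (Sum.inr i) - u' (Sum.inr i)) * u (Sum.inl i) ∈ 𝔪 ^ (n + 2) :=
          mul_mem_pow (m := n + 1) (n := 1) (hcc i) (hU u hu i)
        have h4 : (u (Sum.inl i) - u' (Sum.inl i)) * u' (Sum.inr i) ∈ 𝔪 ^ (n + 2) :=
          mul_mem_pow (hUU i) (hc u' hu' i)
        have h5 : ((u (Sum.inr 0) - u' (Sum.inr 0)) + (u (Sum.inr 1) - u' (Sum.inr 1))) *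
            euler (u (Sum.inl i)) ∈ 𝔪 ^ (n + 2) :=
          mul_mem_pow (m := n + 1) (n := 1) (add_mem (hcc 0) (hcc 1)) (euler_mem_pow (hU u hu i))
        have h6 : euler (u (Sum.inl i) - u' (Sum.inl i)) * (u' (Sum.inr 0) + u' (Sum.inr 1)) ∈
            𝔪 ^ (n + 2) :=
          mul_mem_pow (euler_mem_pow (hUU i)) (add_mem (hc u' hu' 0) (hc u' hu' 1))
        rw [euler_sub] at h6
        have := sub_mem (sub_mem (add_mem (Ideal.mul_mem_right (1 + u (Sum.inl i)) _ h1) h2)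
          (add_mem h3 h4)) (add_mem h5 h6)
        convert this using 1
        simp only [hR]
        ring
      rintro (i | i)
      · simp only [Sum.elim_inl, add_zero]
        rw [← solveResonant_sub]
        exact solveResonant_mem_pow _ (key i)
      · simp only [Sum.elim_inr]
        rw [← map_sub]
        exact diagonal_mem_pow _ (key i))
  have hh : ∀ i, solveResonant (a 0 + a 1) (R u i) = u (Sum.inl i) :=
    fun i => congrFun hfix (Sum.inl i)
  have hcR : ∀ i, diagonal w (R u i) = u (Sum.inr i) := fun i => congrFun hfix (Sum.inr i)
  have hUres : ∀ i, IsResonant (u (Sum.inl i)) :=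
    fun i => isResonant_iff.mpr fun e he => hu _ e fun h => he h.2
  have hcres : ∀ i, IsResonant (u (Sum.inr i)) :=
    fun i => isResonant_iff.mpr fun e he => hu _ e fun h => he h.2.1
  have hone : ∀ i, IsResonant (1 + u (Sum.inl i)) := fun i => (isResonant_C 1).add (hUres i)
  have hRres : ∀ i, IsResonant (R u i) := fun i =>
    (((isResonant_fiberedHom hone (hres i)).mul (hone i)).sub ((hcres i).mul (hUres i))).sub
      (((hcres 0).add (hcres 1)).mul (hUres i).euler)
  have heq : ∀ i, u (Sum.inr i) + (x * (X 0 * pderiv ℂ 0 (u (Sum.inl i))) +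
      C (a 0 + a 1) * x * euler (u (Sum.inl i))) = R u i := by
    intro i
    ext e
    by_cases he : e 1 = e 2
    swap
    · rw [isResonant_iff.mp (hRres i) e he]
      refine isResonant_iff.mp ((hcres i).add (IsResonant.add ?_ ?_)) e he
      · refine isResonant_x.mul (isResonant_iff.mpr fun e he => ?_)
        rw [coeff_X_mul_pderiv, isResonant_iff.mp (hUres i) e he, mul_zero]
      · exact ((isResonant_C _).mul isResonant_x).mul (hUres i).euler
    by_cases h0 : e 0 = 0
    · rw [map_add, map_add, coeff_x_mul_of_eq_zero h0, mul_comm (C _) x, mul_assoc,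
        coeff_x_mul_of_eq_zero h0, add_zero, add_zero, ← hcR, coeff_diagonal]
      simp only [hw, if_pos (And.intro he h0), one_mul]
    · obtain ⟨d, rfl⟩ : ∃ d, e = d + single 0 1 := ⟨e - single 0 1, (tsub_add_cancel_of_le
        (Finsupp.single_le_iff.mpr (Nat.one_le_iff_ne_zero.mpr h0))).symm⟩
      have hd : d 1 = d 2 := by simpa using he
      rw [map_add, coeff_x_mul_euler, hu (Sum.inr i) _ fun h => h0 h.2.2, zero_add, ← hh,
        coeff_solveResonant, if_pos hd]
      -- The case d = 0 is the monomial x, not reached by L; it does not occur in `R`, which lies in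
      -- 𝔪². For other d the scalar is nonzero by non-degeneracy.
      by_cases hz : d = 0
      · subst hz
        rw [mem_pow_iff.mp (hRm u hu i) (0 + single 0 1)
          (by rw [map_add, Finsupp.degree_single]; simp), zero_div, mul_zero]
      · refine mul_div_cancel₀ _ (add_mul_ne_zero ha ?_)
        by_contra! h
        refine hz (Finsupp.ext fun j => ?_)
        fin_cases j
        · exact h.1
        · exact h.2
        · exact hd ▸ h.2
  refine ⟨fun i => u (Sum.inr i), fun i e he => hu _ e fun h => he ⟨?_, h.2⟩, ?_⟩
  · rintro rfl
    exact absurd h.1 (by rw [map_zero]; norm_num)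
  refine exists_smul_eq_of_related (σ := fiberedHom (ψ u)) ?_ (fiberedHom_X_zero (hψm u))
      (fibered_X_zero _) (fibered_X_zero _) fun i => ?_
  · refine algHom_bijective _ fun i => ?_
    refine Fin.cases ?_ (fun i => ?_) i
    · rw [fiberedHom_X_zero (hψm u), sub_self]; exact zero_mem _
    · rw [fiberedHom_X_succ (hψm u)]
      have := (X_mul_mem_pow_iff (i := i.succ)).mpr (hU u hu i)
      convert this using 1
      simp only [hψ]
      ring
  · have h1 := heq i
    have hx : fiberedHom (ψ u) x = x := fiberedHom_X_zero (hψm u)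
    rw [fibered_X_succ, map_mul, map_add, map_add, map_mul, algHom_C, algHom_C, hx,
      fiberedHom_X_succ (hψm u)]
    rw [Derivation.leibniz, fibered_X_succ, fibered_of_isResonant _ (hone i), smul_eq_mul,
      smul_eq_mul]
    have hp : pderiv ℂ 0 (1 + u (Sum.inl i)) = pderiv ℂ 0 (u (Sum.inl i)) := by simp
    have hE : euler (1 + u (Sum.inl i)) = euler (u (Sum.inl i)) := by simp [euler]
    have hev : (C (eigenvalue lam 0) : FormalSeries) + C (eigenvalue lam 1) = 0 := by
      rw [← map_add]; simp [eigenvalue]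
    rw [hp, hE]
    simp only [hR, hψ, map_add] at h1
    linear_combination X i.succ * h1 + X i.succ * euler (u (Sum.inl i)) * hev

/-! ### Series in v = y₁ y₂ -/

theorem coeff_atV (c : PowerSeries ℂ) (e : Fin 3 →₀ ℕ) :
    coeff e (atV c) = if e 0 = 0 ∧ e 1 = e 2 then PowerSeries.coeff (e 1) c else 0 := by
  classical
  have hv : ∀ d : ℕ, coeff e ((y₁ * y₂ : FormalSeries) ^ d) =
      if e 0 = 0 ∧ e 1 = d ∧ e 2 = d then 1 else 0 := by
    intro d
    rw [mul_pow, y₁, y₂, X_pow_eq, X_pow_eq, monomial_mul_monomial, coeff_monomial, one_mul]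
    congr 1
    rw [Finsupp.ext_iff, Fin.forall_fin_succ, Fin.forall_fin_two]
    simp
  rw [atV, PowerSeries.coeff_subst hasSubst_v, finsum_eq_single _ (e 1)]
  · rw [hv, smul_eq_mul]
    by_cases h : e 0 = 0 ∧ e 1 = e 2
    · rw [if_pos h, if_pos ⟨h.1, rfl, h.2.symm⟩, mul_one]
    · rw [if_neg h, if_neg fun h' => h ⟨h'.1, h'.2.2.symm⟩, mul_zero]
  · intro d hd
    rw [hv, if_neg fun h => hd h.2.1.symm, smul_zero]

theorem isResonant_atV (c : PowerSeries ℂ) : IsResonant (atV c) :=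
  isResonant_iff.mpr fun e he => by rw [coeff_atV, if_neg fun h => he h.2]

theorem atV_mem {c : PowerSeries ℂ} (hc : PowerSeries.constantCoeff c = 0) : atV c ∈ 𝔪 ^ 2 := by
  obtain ⟨h, hh⟩ := atV_eq_mul hc
  rw [hh, sq]
  exact Ideal.mul_mem_right _ _ (Ideal.mul_mem_mul y₁_mem y₂_mem)

theorem atV_injective : Function.Injective atV := by
  intro c d h
  ext m
  have := congrArg (coeff (single 1 m + single 2 m)) h
  simpa [coeff_atV] using this

theorem exists_eq_atV {f : FormalSeries}
    (h : ∀ e : Fin 3 →₀ ℕ, ¬ (e ≠ 0 ∧ e 1 = e 2 ∧ e 0 = 0) → coeff e f = 0) :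
    ∃ c : PowerSeries ℂ, PowerSeries.constantCoeff c = 0 ∧ f = atV c := by
  refine ⟨PowerSeries.mk fun m => coeff (single 1 m + single 2 m) f, ?_, ?_⟩
  · rw [← PowerSeries.coeff_zero_eq_constantCoeff_apply, PowerSeries.coeff_mk]
    exact h _ fun h' => h'.1 (by simp)
  · ext e
    rw [coeff_atV, PowerSeries.coeff_mk]
    split_ifs with he
    · congr 2
      rw [Finsupp.ext_iff, Fin.forall_fin_succ, Fin.forall_fin_two]
      simp [he.1, he.2]
    · exact h e fun h' => he ⟨h'.2.2, h'.2.1⟩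

/-- As σ is not assumed to respect infinite sums, the two sides are compared modulo each 𝔪ⁿ: writing
c = c(0) + X d factors θ v ∈ 𝔪 out of the difference. -/
theorem algHom_atV {σ : FormalSeries →ₐ[ℂ] FormalSeries} {θ : ℂ}
    (h : σ (y₁ * y₂) = C θ * (y₁ * y₂)) (c : PowerSeries ℂ) :
    σ (atV c) = atV (PowerSeries.rescale θ c) := by
  rw [← sub_eq_zero]
  refine eq_zero_of_forall_mem_pow fun n => ?_
  induction n generalizing c with
  | zero => simp
  | succ n ih =>
    obtain ⟨d, hd⟩ : PowerSeries.X ∣ c - PowerSeries.C (PowerSeries.constantCoeff c) :=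
      PowerSeries.X_dvd_iff.mpr (by simp)
    rw [sub_eq_iff_eq_add'] at hd
    have hC : ∀ z : ℂ, atV (PowerSeries.C z) = C z := fun z => by
      rw [atV, PowerSeries.subst_C]
    have hX : ∀ d, atV (PowerSeries.X * d) = y₁ * y₂ * atV d := fun d => by
      rw [atV, PowerSeries.subst_mul hasSubst_v, PowerSeries.subst_X hasSubst_v]; rfl
    have hadd : ∀ c d, atV (c + d) = atV c + atV d := fun c d =>
      PowerSeries.subst_add hasSubst_v c d
    have hre : PowerSeries.rescale θ (PowerSeries.X * d) =
        PowerSeries.X * (PowerSeries.C θ * PowerSeries.rescale θ d) := by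
      rw [map_mul, PowerSeries.rescale_X]; ring
    have hC' : PowerSeries.rescale θ (PowerSeries.C (PowerSeries.constantCoeff c)) =
        PowerSeries.C (PowerSeries.constantCoeff c) := by
      ext n
      rw [PowerSeries.coeff_rescale, PowerSeries.coeff_C]
      split_ifs with hn
      · rw [hn, pow_zero, one_mul]
      · rw [mul_zero]
    have hCm : atV (PowerSeries.C θ * PowerSeries.rescale θ d) =
        C θ * atV (PowerSeries.rescale θ d) := by
      rw [atV, PowerSeries.subst_mul hasSubst_v]; exact congrArg (· * _) (hC θ)
    rw [hd]
    rw [map_add (PowerSeries.rescale θ), hre, hC', hadd, hadd, hX, hX, hCm, hC, map_add, map_mul, h,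
      algHom_C]
    have := mul_mem_pow (m := 1) (n := n) (f := C θ * (y₁ * y₂))
      (by rw [pow_one]; exact Ideal.mul_mem_left _ _ (Ideal.mul_mem_right _ _ y₁_mem)) (ih d)
    refine pow_anti (by omega) (?_ : _ ∈ 𝔪 ^ (1 + n))
    convert this using 1
    ring

/-! ### Existence of normal forms -/

/-- The pair `(a₁, a₂)`. -/
def ParamSpace.a (p : ParamSpace) : Fin 2 → ℂ := ![p.a₁, p.a₂]

/-- The pair `(c₁, c₂)`. -/
def ParamSpace.c (p : ParamSpace) : Fin 2 → PowerSeries ℂ := ![p.c₁, p.c₂]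

theorem ParamSpace.c_zero (p : ParamSpace) (i : Fin 2) : PowerSeries.constantCoeff (p.c i) = 0 := by
  fin_cases i
  · exact p.c₁_zero
  · exact p.c₂_zero

/-- The factors `aᵢ x + cᵢ(v)`. -/
def ParamSpace.κ (p : ParamSpace) (i : Fin 2) : FormalSeries := C (p.a i) * x + atV (p.c i)

theorem ParamSpace.κ_mem (p : ParamSpace) (i : Fin 2) : p.κ i ∈ 𝔪 :=
  add_mem (Ideal.mul_mem_left _ _ x_mem) (Ideal.pow_le_self two_ne_zero (atV_mem (p.c_zero i)))

theorem ParamSpace.isResonant_κ (p : ParamSpace) (i : Fin 2) : IsResonant (p.κ i) :=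
  ((isResonant_C _).mul isResonant_x).add (isResonant_atV _)

theorem normalFormField_eq (p : ParamSpace) :
    normalFormField p = fibered fun i => (C (eigenvalue p.lam i) + p.κ i) * X i.succ := by
  rw [normalFormField, fibered]
  simp only [eigenvalue, ParamSpace.κ, ParamSpace.a, ParamSpace.c, Matrix.cons_val_zero,
    Matrix.cons_val_one, map_neg, ← add_assoc]
  rfl

/-- Conjugacy of vector fields under fibered diffeomorphisms. -/
def Conj (Y Z : VectorField) : Prop := ∃ Φ : FiberedDiffeo, Φ • Y = Z

theorem Conj.refl (Y : VectorField) : Conj Y Y := ⟨1, one_smul _ _⟩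

theorem Conj.symm {Y Z : VectorField} (h : Conj Y Z) : Conj Z Y := by
  obtain ⟨Φ, rfl⟩ := h
  exact ⟨Φ⁻¹, inv_smul_smul _ _⟩

theorem Conj.trans {Y Z W : VectorField} (h : Conj Y Z) (h' : Conj Z W) : Conj Y W := by
  obtain ⟨Φ, rfl⟩ := h
  obtain ⟨Ψ, rfl⟩ := h'
  exact ⟨Ψ * Φ, mul_smul _ _ _⟩

/-- Every non-degenerate doubly-resonant saddle-node is conjugate to a normal form. -/
theorem exists_conj_normalFormField {Y : VectorField} (hY : IsNondegenerate Y) :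
    ∃ p : ParamSpace, Conj Y (normalFormField p) := by
  obtain ⟨-, r, ⟨Φ₀, ⟨lam, hlam, F₁, hF₁, F₂, hF₂, hprep⟩, hr⟩, hr'⟩ := hY
  set F : Fin 2 → FormalSeries := ![F₁, F₂] with hF
  have hFm : ∀ i, F i ∈ 𝔪 ^ 2 := by
    intro i; fin_cases i
    · exact hF₁
    · exact hF₂
  have hprep' : Φ₀ • Y = fibered (fun i => C (eigenvalue lam i) * X i.succ + F i) := by
    rw [hprep, fibered, smul_eq_C_mul, smul_eq_C_mul]
    simp [eigenvalue, hF, y₁, y₂]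
  obtain ⟨N, hN, hlin, hcoef, Φ₁, hΦ₁⟩ := exists_smul_eq_resonant (lam := lam) hFm
  choose A hA hNA using fun i => exists_isResonant_mul hlam (hlin i)
  set a : Fin 2 → ℂ := fun i => coeff (single 0 1) (A i) with ha
  have hFa : ∀ i, coeff (single 0 1 + single i.succ 1) (F i) = a i := by
    intro i
    rw [← hcoef, hNA, X, coeff_add_mul_monomial, mul_one]
  have hra : r = a 0 + a 1 := by
    rw [← hr, preparedResidue, Matrix.trace_fin_two, map_add, linearPart]
    simp only [Matrix.of_apply, PowerSeries.coeff_mk]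
    have : ∀ i : Fin 2, coeff (single 0 1 + single i.succ 1) ((Φ₀ • Y) (X i.succ)) = a i := by
      intro i
      rw [hprep', fibered_X_succ, map_add, hFa, coeff_C_mul, coeff_X, if_neg, mul_zero, zero_add]
      intro h
      have := DFunLike.congr_fun h 0
      simp [Fin.succ_ne_zero] at this
    rw [this, this]
  set B : Fin 2 → FormalSeries := fun i => A i - C (a i) * x with hB
  have hBres : ∀ i, IsResonant (B i) := fun i =>
    (hA i).sub ((isResonant_C _).mul isResonant_x)
  have hAm : ∀ i, A i ∈ 𝔪 ^ 1 := fun i => by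
    rw [← X_mul_mem_pow_iff (i := i.succ), mul_comm, ← hNA]
    exact hN i
  have hBm : ∀ i, B i ∈ 𝔪 ^ 2 := by
    intro i
    have hB1 : B i ∈ 𝔪 ^ 1 := sub_mem (hAm i)
      (by rw [pow_one]; exact Ideal.mul_mem_left _ _ x_mem)
    rw [mem_pow_iff]
    intro e he
    -- The resonant monomials of degree less than two are 1 and x: the first is excluded by `hB1`,
    -- the coefficient of the second was subtracted.
    by_cases h12 : e 1 = e 2
    · by_cases h0 : e.degree < 1
      · exact mem_pow_iff.mp hB1 e h0
      · have he' : e = single 0 1 := by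
          rw [degree_eq_sum] at he h0
          rw [Finsupp.ext_iff, Fin.forall_fin_succ, Fin.forall_fin_two]
          refine ⟨?_, ?_, ?_⟩
          · rw [Finsupp.single_eq_same]; omega
          · change e 1 = _
            rw [Finsupp.single_eq_of_ne (by decide)]; omega
          · change e 2 = _
            rw [Finsupp.single_eq_of_ne (by decide)]; omega
        subst he'
        simp only [hB, ha, map_sub, coeff_C_mul, x, coeff_X, if_true, mul_one, sub_self]
    · exact isResonant_iff.mp (hBres i) e h12
  obtain ⟨c, hc, Φ₂, hΦ₂⟩ := exists_smul_eq_normal (lam := lam) (a := a) (hra ▸ hr') hBm hBres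
  choose d hd hcd using fun i => exists_eq_atV (hc i)
  refine ⟨⟨lam, a 0, a 1, d 0, d 1, hlam, hra ▸ hr', hd 0, hd 1⟩,
    Φ₂ * Φ₁ * Φ₀, ?_⟩
  have e1 : fibered (fun i => C (eigenvalue lam i) * X i.succ + N i) =
      fibered (fun i => (C (eigenvalue lam i) + C (a i) * x + B i) * X i.succ) := by
    congr 1
    funext i
    rw [hNA i]
    simp only [hB]
    ring
  rw [mul_smul, mul_smul, hprep', hΦ₁, e1, hΦ₂, normalFormField_eq]
  congr 1
  funext i
  rw [hcd i, ParamSpace.κ, ← add_assoc]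
  fin_cases i <;> rfl

/-! ### Conjugacies realizing the group action -/

theorem fiberedHom_bijective_of_inverse {g g' : Fin 2 → FormalSeries} (hg : ∀ i, g i ∈ 𝔪)
    (hg' : ∀ i, g' i ∈ 𝔪) (h : ∀ i, fiberedHom g (g' i) = X i.succ)
    (h' : ∀ i, fiberedHom g' (g i) = X i.succ) : Function.Bijective (fiberedHom g) := by
  have aux : ∀ {g g' : Fin 2 → FormalSeries}, (∀ i, g i ∈ 𝔪) → (∀ i, g' i ∈ 𝔪) →
      (∀ i, fiberedHom g (g' i) = X i.succ) → ∀ f, fiberedHom g (fiberedHom g' f) = f := by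
    intro g g' hg hg' h f
    have : (fiberedHom g).comp (fiberedHom g') = AlgHom.id ℂ _ := algHom_ext fun i => by
      refine Fin.cases ?_ (fun i => ?_) i
      · rw [AlgHom.comp_apply, fiberedHom_X_zero hg', fiberedHom_X_zero hg]; rfl
      · rw [AlgHom.comp_apply, fiberedHom_X_succ hg', h]; rfl
    exact DFunLike.congr_fun this f
  exact Function.bijective_iff_has_inverse.mpr ⟨fiberedHom g', aux hg' hg h', aux hg hg' h⟩

theorem fiberedHom_C_mul_X_v {β : Fin 2 → ℂ} :
    fiberedHom (fun i => C (β i) * X i.succ) (y₁ * y₂) = C (β 0 * β 1) * (y₁ * y₂) := by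
  have hm : ∀ i : Fin 2, C (β i) * X i.succ ∈ 𝔪 := fun i => Ideal.mul_mem_left _ _ (X_mem _)
  have h1 : fiberedHom (fun i => C (β i) * X i.succ) y₁ = C (β 0) * y₁ := fiberedHom_X_succ hm 0
  have h2 : fiberedHom (fun i => C (β i) * X i.succ) y₂ = C (β 1) * y₂ := fiberedHom_X_succ hm 1
  rw [map_mul, h1, h2, map_mul]
  ring

/-- The linear map y₁ ↦ θ y₁ preserves every yᵢ ∂/∂yᵢ and multiplies v by θ. -/
theorem conj_normalFormField_smul (θ : ℂˣ) (p : ParamSpace) :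
    Conj (normalFormField p) (normalFormField (θ • p)) := by
  set β : Fin 2 → ℂ := ![(θ : ℂ), 1] with hβ
  have hβ0 : ∀ i, β i ≠ 0 := by
    intro i; fin_cases i
    · exact θ.ne_zero
    · exact one_ne_zero
  have hm : ∀ β : Fin 2 → ℂ, ∀ i : Fin 2, C (β i) * X i.succ ∈ 𝔪 :=
    fun β i => Ideal.mul_mem_left _ _ (X_mem _)
  have hinv : ∀ β β' : Fin 2 → ℂ, (∀ i, β i * β' i = 1) → ∀ i : Fin 2,
      fiberedHom (fun i => C (β i) * X i.succ) (C (β' i) * X i.succ) = X i.succ := by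
    intro β β' h i
    rw [map_mul, algHom_C, fiberedHom_X_succ (hm β), ← mul_assoc, ← map_mul, mul_comm, mul_comm,
      mul_comm (β' i), h, map_one, one_mul]
  rw [normalFormField_eq, normalFormField_eq]
  refine exists_smul_eq_of_related (σ := fiberedHom fun i => C (β i) * X i.succ)
    (fiberedHom_bijective_of_inverse (hm β) (hm fun i => (β i)⁻¹)
      (hinv β _ fun i => mul_inv_cancel₀ (hβ0 i)) (hinv _ β fun i => inv_mul_cancel₀ (hβ0 i)))
    (fiberedHom_X_zero (hm β)) (fibered_X_zero _) (fibered_X_zero _) fun i => ?_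
  have hx : fiberedHom (fun i => C (β i) * X i.succ) x = x := fiberedHom_X_zero (hm β)
  have hc : PowerSeries.rescale (β 0 * β 1) (p.c i) = (θ • p).c i := by
    simp only [hβ, Matrix.cons_val_zero, Matrix.cons_val_one, mul_one]
    fin_cases i <;> rfl
  have ha : (θ • p).a i = p.a i := rfl
  have hl : (θ • p).lam = p.lam := rfl
  rw [fibered_X_succ, map_mul, map_add, algHom_C, fiberedHom_X_succ (hm β), ParamSpace.κ, map_add,
    map_mul (fiberedHom _), hx, algHom_C, algHom_atV fiberedHom_C_mul_X_v, hc, Derivation.leibniz,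
    fibered_X_succ, ParamSpace.κ, ha, hl, ← smul_eq_C_mul]
  have : fibered (fun i => (C (eigenvalue p.lam i) + (θ • p).κ i) * X i.succ) (C (β i)) = 0 := by
    simp [fibered_apply]
  simp only [smul_eq_C_mul, smul_eq_mul]
  linear_combination X i.succ * this

/-- Exchanging y₁ and y₂ fixes v and permutes the two components. -/
theorem conj_normalFormField_swap (p : ParamSpace) :
    Conj (normalFormField p) (normalFormField p.swap) := by
  set g : Fin 2 → FormalSeries := fun i => X (Fin.rev i).succ with hg
  have hm : ∀ i, g i ∈ 𝔪 := fun i => X_mem _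
  have hinv : ∀ i, fiberedHom g (g i) = X i.succ := fun i => by
    rw [hg, fiberedHom_X_succ hm]
    exact congrArg (fun j : Fin 2 => (X j.succ : FormalSeries)) (Fin.rev_rev i)
  have hv : fiberedHom g (y₁ * y₂) = C 1 * (y₁ * y₂) := by
    have h1 : fiberedHom g y₁ = y₂ := fiberedHom_X_succ hm 0
    have h2 : fiberedHom g y₂ = y₁ := fiberedHom_X_succ hm 1
    rw [map_mul, h1, h2, map_one, one_mul, mul_comm]
  rw [normalFormField_eq, normalFormField_eq]
  refine exists_smul_eq_of_related (σ := fiberedHom g)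
    (fiberedHom_bijective_of_inverse hm hm hinv hinv)
    (fiberedHom_X_zero hm) (fibered_X_zero _) (fibered_X_zero _) fun i => ?_
  have hx : fiberedHom g x = x := fiberedHom_X_zero hm
  have hl : eigenvalue p.swap.lam i.rev = eigenvalue p.lam i := by
    fin_cases i <;> simp [eigenvalue, ParamSpace.swap]
  have ha : p.swap.a i.rev = p.a i := by fin_cases i <;> rfl
  have hc : p.swap.c i.rev = p.c i := by fin_cases i <;> rfl
  rw [fibered_X_succ, map_mul, map_add, algHom_C, fiberedHom_X_succ hm, ParamSpace.κ, map_add,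
    map_mul (fiberedHom _), hx, algHom_C, algHom_atV hv, PowerSeries.rescale_one, RingHom.id_apply, hg,
    fibered_X_succ, ParamSpace.κ, ha, hl, hc]

/-! ### Rigidity of conjugacies between normal forms -/

theorem normalFormField_apply (p : ParamSpace) (f : FormalSeries) :
    normalFormField p f = linearField p.lam f + fibered (fun i => p.κ i * X i.succ) f := by
  rw [normalFormField_eq, ← fibered_eigenvalue_add]
  simp only [add_mul]

theorem κ_mul_X_mem (p : ParamSpace) (i : Fin 2) : p.κ i * X i.succ ∈ 𝔪 ^ 2 := by
  rw [sq]; exact Ideal.mul_mem_mul (p.κ_mem i) (X_mem _)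

/-- The linear part commutes with the nonlinear part of a normal form. -/
theorem linearField_comm (lam : ℂ) (p : ParamSpace) (f : FormalSeries) :
    linearField lam (fibered (fun i => p.κ i * X i.succ) f) =
      fibered (fun i => p.κ i * X i.succ) (linearField lam f) := by
  have h : ⁅linearField lam, fibered (fun i => p.κ i * X i.succ)⁆ = 0 := by
    refine vectorField_ext fun i => ?_
    rw [Derivation.commutator_apply, Derivation.zero_apply, sub_eq_zero]
    refine Fin.cases ?_ (fun i => ?_) i
    · rw [fibered_X_zero, linearField_X_zero, map_zero]
      exact (isResonant_x.mul isResonant_x |>.linearField_eq_zero lam) ▸ congrArg _ (sq x)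
    · rw [fibered_X_succ, linearField_X_succ, Derivation.leibniz, Derivation.leibniz,
        (p.isResonant_κ i).linearField_eq_zero, linearField_X_succ, fibered_X_succ]
      have : fibered (fun i => p.κ i * X i.succ) (C (eigenvalue lam i)) = 0 := by
        simp [fibered_apply]
      rw [this]
      simp only [smul_eq_mul]
      ring
  have := DFunLike.congr_fun h f
  rwa [Derivation.commutator_apply, Derivation.zero_apply, sub_eq_zero] at this

/-- The exponents of degree one occurring in the image of `yᵢ` under a conjugacy of normal
forms. -/
theorem weight_eq_of_related {p q : ParamSpace} {σ : FormalSeries →ₐ[ℂ] FormalSeries}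
    (hσ : ∀ f, normalFormField q (σ f) = σ (normalFormField p f)) {i : Fin 2}
    {e : Fin 3 →₀ ℕ} (he : e.degree < 2) (hne : coeff e (σ (X i.succ)) ≠ 0) :
    q.lam * ((e 2 : ℂ) - e 1) = eigenvalue p.lam i := by
  have h1 := hσ (X i.succ)
  have hm : σ (X i.succ) ∈ 𝔪 := algHom_mem σ (X_mem _)
  rw [normalFormField_apply, normalFormField_apply, fibered_X_succ, linearField_X_succ, map_add,
    map_mul, algHom_C, map_mul] at h1
  -- Modulo 𝔪² only the linear fields remain, and σ yᵢ is an eigenvector for them.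
  have h2 : fibered (fun i => q.κ i * X i.succ) (σ (X i.succ)) ∈ 𝔪 ^ 2 :=
    fibered_mem (κ_mul_X_mem q) (k := 0) (by simpa using hm)
  have h3 : σ (p.κ i) * σ (X i.succ) ∈ 𝔪 ^ 2 := by
    rw [sq]; exact Ideal.mul_mem_mul (algHom_mem σ (p.κ_mem i)) hm
  have h4 := congrArg (coeff e) h1
  rw [map_add, map_add, mem_pow_iff.mp h2 e he, mem_pow_iff.mp h3 e he, add_zero, add_zero,
    coeff_linearField, coeff_C_mul] at h4
  exact mul_right_cancel₀ hne h4

theorem exists_coeff_ne_zero {f : FormalSeries} (hf : f ∉ 𝔪 ^ 2) :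
    ∃ e : Fin 3 →₀ ℕ, e.degree < 2 ∧ coeff e f ≠ 0 := by
  by_contra! h
  exact hf (mem_pow_iff.mpr h)

/-- The linear part of σ y₁ is nonzero; its monomials x, y₁, y₂ have weights 0, -λ_q, λ_q, and those
that occur must have the nonzero weight -λ_p. -/
theorem lam_eq_or_of_related {p q : ParamSpace} {σ : FormalSeries →ₐ[ℂ] FormalSeries}
    (hσ : ∀ f, normalFormField q (σ f) = σ (normalFormField p f))
    (hinj : ∀ i : Fin 2, σ (X i.succ) ∉ 𝔪 ^ 2) : q.lam = p.lam ∨ q.lam = -p.lam := by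
  obtain ⟨e, he, hne⟩ := exists_coeff_ne_zero (hinj 0)
  have hw : q.lam * ((e 2 : ℂ) - e 1) = -p.lam := weight_eq_of_related hσ he hne
  have hp := p.lam_ne_zero
  rw [degree_eq_sum] at he
  obtain ⟨h1, h2⟩ | ⟨h1, h2⟩ | ⟨h1, h2⟩ : (e 1 = 0 ∧ e 2 = 0) ∨ (e 1 = 1 ∧ e 2 = 0) ∨
      (e 1 = 0 ∧ e 2 = 1) := by omega
  · rw [h1, h2, sub_self, mul_zero] at hw
    exact absurd (neg_eq_zero.mp hw.symm) hp
  · rw [h1, h2] at hw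
    left; push_cast at hw; linear_combination -hw
  · rw [h1, h2] at hw
    right; push_cast at hw; linear_combination hw

/-- A conjugacy of normal forms with the same `λ` preserves the linear part. -/
theorem linearField_of_related {p q : ParamSpace} {σ : FormalSeries →ₐ[ℂ] FormalSeries}
    (hσ : ∀ f, normalFormField q (σ f) = σ (normalFormField p f)) (hx : σ (X 0) = X 0)
    (hlam : q.lam = p.lam) (i : Fin 2) :
    linearField p.lam (σ (X i.succ)) = C (eigenvalue p.lam i) * σ (X i.succ) := by
  set S := linearField p.lam with hS
  set N := fibered (fun i => q.κ i * X i.succ) with hN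
  set ρ : Fin 2 → FormalSeries := fun i => S (σ (X i.succ)) - C (eigenvalue p.lam i) * σ (X i.succ)
    with hρ
  have hm : ∀ i : Fin 2, σ (X i.succ) ∈ 𝔪 := fun i => algHom_mem σ (X_mem _)
  have heq : ∀ i, ρ i + N (σ (X i.succ)) = σ (p.κ i) * σ (X i.succ) := by
    intro i
    have h1 := hσ (X i.succ)
    rw [normalFormField_apply, normalFormField_apply, fibered_X_succ, linearField_X_succ, map_add,
      map_mul, algHom_C, map_mul, hlam] at h1
    linear_combination h1
  have key : ∀ n, ∀ i, ρ i ∈ 𝔪 ^ (n + 1) := by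
    intro n
    induction n with
    | zero =>
      intro i
      rw [zero_add]
      have : σ (X i.succ) ∈ 𝔪 ^ 1 := by simpa using hm i
      exact sub_mem (linearField_mem_pow _ this) (Ideal.mul_mem_left _ _ this)
    | succ n ih =>
      intro i
      -- S σ - σ S takes the values ρ on y₁, y₂ and 0 on x, so it inherits their order; on the
      -- resonant κᵢ it equals S (σ κᵢ).
      have hD : S (σ (p.κ i)) ∈ 𝔪 ^ (n + 1) := by
        have := (isSkew_conj S S σ).map_mem (r := n + 1) (fun j => by
          simp only [LinearMap.sub_apply, LinearMap.comp_apply, AlgHom.toLinearMap_apply,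
            Derivation.coeFn_coe]
          refine Fin.cases ?_ (fun j => ?_) j
          · rw [hx, hS, linearField_X_zero, map_zero, sub_zero]
            exact zero_mem _
          · rw [hS, linearField_X_succ, map_mul, algHom_C]
            exact ih j) (p.κ i)
        simp only [LinearMap.sub_apply, LinearMap.comp_apply, AlgHom.toLinearMap_apply,
            Derivation.coeFn_coe] at this
        rwa [hS, (p.isResonant_κ i).linearField_eq_zero, map_zero, sub_zero] at this
      have h1 : S (ρ i) - C (eigenvalue p.lam i) * ρ i =
          S (σ (p.κ i)) * σ (X i.succ) + σ (p.κ i) * ρ i - N (ρ i) := by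
        have h2 := congrArg S (heq i)
        rw [map_add, hS, hN, linearField_comm, ← hS, ← hN, Derivation.leibniz, smul_eq_mul,
          smul_eq_mul] at h2
        have h3 : N (ρ i) =
            N (S (σ (X i.succ))) - C (eigenvalue p.lam i) * N (σ (X i.succ)) := by
          simp only [hρ, map_sub, Derivation.leibniz, smul_eq_mul]
          have : N (C (eigenvalue p.lam i)) = 0 := by simp [hN, fibered_apply]
          rw [this]
          ring
        have h4 := heq i
        simp only [hρ] at h2 h3 h4 ⊢
        linear_combination h2 + h3 - C (eigenvalue p.lam i) * h4
      have h5 : S (ρ i) - C (eigenvalue p.lam i) * ρ i ∈ 𝔪 ^ (n + 2) := by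
        rw [h1]
        refine sub_mem (add_mem ?_ ?_) ?_
        · exact mul_mem_pow (n := 1) hD (by simpa using hm i)
        · rw [mul_comm]
          exact mul_mem_pow (n := 1) (ih i) (by simpa using algHom_mem σ (p.κ_mem i))
        · exact pow_anti (by omega) (fibered_mem (κ_mul_X_mem q) (ih i))
      rw [mem_pow_iff] at h5 ⊢
      intro e he
      have h6 := h5 e he
      rw [map_sub, hS, coeff_linearField, coeff_C_mul, ← sub_mul] at h6
      have h7 : coeff e (ρ i) = (p.lam * ((e 2 : ℂ) - e 1) - eigenvalue p.lam i) *
          coeff e (σ (X i.succ)) := by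
        simp only [hρ, hS]
        rw [map_sub, coeff_linearField, coeff_C_mul, ← sub_mul]
      -- Semisimplicity of S: ρ is already an image of S - μᵢ, so a coefficient killed by the scalar
      -- of S - μᵢ vanishes anyway.
      rcases mul_eq_zero.mp h6 with h | h
      · rw [h7, h, zero_mul]
      · exact h
  have : ρ i = 0 := eq_zero_of_forall_mem_pow fun n => pow_anti (Nat.le_succ n) (key n i)
  exact sub_eq_zero.mp this

/-- Two conjugate normal forms with the same `λ` differ by a rescaling. -/
theorem exists_rescale_of_related {p q : ParamSpace} {σ : FormalSeries →ₐ[ℂ] FormalSeries}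
    (hσ : ∀ f, normalFormField q (σ f) = σ (normalFormField p f)) (hx : σ (X 0) = X 0)
    (hinj : ∀ i : Fin 2, σ (X i.succ) ∉ 𝔪 ^ 2) (hlam : q.lam = p.lam) :
    ∃ θ : ℂ, θ ≠ 0 ∧ ∀ i, q.a i = p.a i ∧ q.c i = PowerSeries.rescale θ (p.c i) := by
  choose f hf hσf using fun i =>
    exists_isResonant_mul p.lam_ne_zero (linearField_of_related hσ hx hlam i)
  set β : Fin 2 → ℂ := fun i => constantCoeff (f i) with hβ
  have hβ0 : ∀ i, β i ≠ 0 := by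
    intro i h0
    refine hinj i ?_
    rw [hσf, sq]
    exact Ideal.mul_mem_mul ((mem_maximalIdeal_iff _).mpr h0) (X_mem _)
  have hx' : σ x = x := hx
  have heq : ∀ i, x * (X 0 * pderiv ℂ 0 (f i)) + (q.κ 0 + q.κ 1) * euler (f i) =
      (σ (p.κ i) - q.κ i) * f i := by
    intro i
    have h1 := hσ (X i.succ)
    have h2 : linearField q.lam (f i) = 0 := (hf i).linearField_eq_zero _
    rw [normalFormField_apply, normalFormField_apply, fibered_X_succ, linearField_X_succ, map_add,
      map_mul, algHom_C, map_mul, hσf, hlam, Derivation.leibniz, Derivation.leibniz,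
      linearField_X_succ, ← hlam, h2, fibered_X_succ, fibered_of_isResonant q.κ (hf i)] at h1
    refine X_mul_cancel (i := i.succ) ?_
    simp only [smul_eq_mul] at h1
    linear_combination h1
  have hcm : ∀ i, atV (q.c i) ∈ 𝔪 ^ 2 := fun i => atV_mem (q.c_zero i)
  set E : FormalSeries → FormalSeries := fun g =>
    x * (X 0 * pderiv ℂ 0 g) + C (q.a 0 + q.a 1) * x * euler g with hE
  have heq' : ∀ i, E (f i) + (atV (q.c 0) + atV (q.c 1)) * euler (f i) =
      (C (p.a i - q.a i) * x + (σ (atV (p.c i)) - atV (q.c i))) * f i := by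
    intro i
    have := heq i
    simp only [ParamSpace.κ, map_add, map_mul, algHom_C, hx'] at this
    simp only [hE, map_add, map_sub]
    linear_combination this
  -- The coefficient of x in `heq'` is (p.a i - q.a i) βᵢ on the right, and zero on the left.
  have ha : ∀ i, q.a i = p.a i := by
    intro i
    have h1 := congrArg (coeff (0 + single 0 1)) (heq' i)
    have h2 : ∀ g ∈ 𝔪 ^ 2, coeff (0 + single (0 : Fin 3) 1) g = 0 := fun g hg =>
      mem_pow_iff.mp hg _ (by rw [zero_add, Finsupp.degree_single]; norm_num)
    rw [map_add, coeff_x_mul_euler, h2 _ (Ideal.mul_mem_right _ _ (add_mem (hcm 0) (hcm 1))),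
      add_mul (C _ * x), map_add, h2 _ (Ideal.mul_mem_right _ _
        (sub_mem (algHom_mem_pow σ (atV_mem (p.c_zero i))) (hcm i))),
      mul_assoc, coeff_C_mul, coeff_x_mul] at h1
    simp only [Finsupp.coe_zero, Pi.zero_apply, Nat.cast_zero, mul_zero, add_zero, zero_mul,
      coeff_zero_eq_constantCoeff_apply] at h1
    exact (sub_eq_zero.mp ((mul_eq_zero.mp h1.symm).resolve_right (hβ0 i))).symm
  have hτm : ∀ i : Fin 2, C (β i) * X i.succ ∈ 𝔪 := fun i => Ideal.mul_mem_left _ _ (X_mem _)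
  set γ : Fin 2 → FormalSeries :=
    fun i => atV (PowerSeries.rescale (β 0 * β 1) (p.c i)) - atV (q.c i) with hγ
  have hγm : ∀ i, γ i ∈ 𝔪 ^ 2 := fun i => by
    refine sub_mem (atV_mem ?_) (hcm i)
    rw [← PowerSeries.coeff_zero_eq_constantCoeff_apply, PowerSeries.coeff_rescale,
      PowerSeries.coeff_zero_eq_constantCoeff_apply, p.c_zero, mul_zero]
  -- If fᵢ ≡ βᵢ modulo 𝔪ⁿ, then σ agrees on the coordinates with yᵢ ↦ βᵢ yᵢ modulo 𝔪ⁿ⁺¹, hence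
  -- modulo 𝔪ⁿ⁺² on series in 𝔪².
  have hstep : ∀ n, (∀ i, f i - C (β i) ∈ 𝔪 ^ n) → ∀ i, E (f i) - C (β i) * γ i ∈ 𝔪 ^ (n + 2) := by
    intro n hn i
    have h1 : σ (atV (p.c i)) - atV (PowerSeries.rescale (β 0 * β 1) (p.c i)) ∈ 𝔪 ^ (n + 2) := by
      rw [← algHom_atV fiberedHom_C_mul_X_v]
      refine algHom_sub_mem (r := n + 1) (k := 1) _ _ (fun j => ?_) (atV_mem (p.c_zero i))
      refine Fin.cases ?_ (fun j => ?_) j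
      · rw [hx, fiberedHom_X_zero hτm, sub_self]; exact zero_mem _
      · rw [fiberedHom_X_succ hτm, hσf, ← sub_mul, mul_comm]
        exact X_mul_mem_pow_iff.mpr (hn j)
    have h2 : (f i - C (β i)) * γ i ∈ 𝔪 ^ (n + 2) := mul_mem_pow (hn i) (hγm i)
    have h3 : euler (f i - C (β i)) * (atV (q.c 0) + atV (q.c 1)) ∈ 𝔪 ^ (n + 2) :=
      mul_mem_pow (euler_mem_pow (hn i)) (add_mem (hcm 0) (hcm 1))
    have h4 : euler (f i - C (β i)) = euler (f i) := by
      rw [euler_sub]; simp [euler]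
    rw [h4] at h3
    have := sub_mem (add_mem (Ideal.mul_mem_right (f i) _ h1) h2) h3
    convert this using 1
    have h5 := heq' i
    rw [ha i, sub_self, map_zero] at h5
    simp only [hγ]
    linear_combination h5
  have hconst : ∀ n, ∀ i, f i - C (β i) ∈ 𝔪 ^ n := by
    intro n
    induction n with
    | zero => simp
    | succ n ih =>
      intro i
      rw [mem_pow_iff]
      intro e he
      by_cases hz : e = 0
      · subst hz
        rw [coeff_zero_eq_constantCoeff_apply, map_sub, constantCoeff_C, sub_self]
      have he0 : coeff e (C (β i) : FormalSeries) = 0 := by rw [coeff_C, if_neg hz]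
      rw [map_sub, he0, sub_zero]
      by_cases h12 : e 1 = e 2
      swap
      · exact isResonant_iff.mp (hf i) e h12
      have h1 := mem_pow_iff.mp (hstep n ih i) (e + single 0 1)
        (by rw [map_add, Finsupp.degree_single]; omega)
      -- γᵢ is free of x, so it cannot compensate the coefficients of E fᵢ; non-degeneracy then
      -- removes those of fᵢ.
      have h2 : coeff (e + single 0 1) (γ i) = 0 := by
        simp only [hγ]
        rw [map_sub, coeff_atV, coeff_atV, if_neg (by simp), if_neg (by simp), sub_self]
      rw [map_sub, coeff_C_mul, h2, mul_zero, sub_zero, coeff_x_mul_euler] at h1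
      refine (mul_eq_zero.mp h1).resolve_left (add_mul_ne_zero q.nondeg ?_)
      by_contra! h
      refine hz (Finsupp.ext fun j => ?_)
      fin_cases j
      · exact h.1
      · exact h.2
      · exact h12 ▸ h.2
  refine ⟨β 0 * β 1, mul_ne_zero (hβ0 0) (hβ0 1), fun i => ⟨ha i, ?_⟩⟩
  have h1 : f i = C (β i) := sub_eq_zero.mp (eq_zero_of_forall_mem_pow fun n => hconst n i)
  have h2 : E (f i) - C (β i) * γ i = 0 :=
    eq_zero_of_forall_mem_pow fun n => pow_anti (by omega) (hstep n (hconst n) i)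
  have h3 : E (f i) = 0 := by rw [h1]; simp [hE, euler]
  rw [h3, zero_sub, neg_eq_zero, mul_eq_zero] at h2
  have h4 : (C (β i) : FormalSeries) ≠ 0 := fun h => hβ0 i (by
    simpa using congrArg constantCoeff h)
  exact (atV_injective (sub_eq_zero.mp (h2.resolve_left h4))).symm

/-- A conjugacy, read on pull-backs. -/
theorem Conj.exists_related {Y Z : VectorField} (h : Conj Y Z) :
    ∃ σ : FormalSeries →ₐ[ℂ] FormalSeries, (∀ f, Z (σ f) = σ (Y f)) ∧ σ (X 0) = X 0 ∧
      ∀ i : Fin 2, σ (X i.succ) ∉ 𝔪 ^ 2 := by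
  obtain ⟨Φ, rfl⟩ := h
  set τ := Φ.1.pullback with hτ
  refine ⟨τ.symm, fun f => ?_, ?_, fun i hi => ?_⟩
  · change τ.symm (Y (τ (τ.symm f))) = τ.symm (Y f)
    rw [AlgEquiv.apply_symm_apply]
  · change τ.symm x = x
    rw [AlgEquiv.symm_apply_eq]
    exact Φ.2.symm
  · have := algHom_mem_pow (τ : FormalSeries →ₐ[ℂ] FormalSeries) hi
    have h2 : (X i.succ : FormalSeries) ∈ 𝔪 ^ 2 := by
      have e : τ (τ.symm (X i.succ)) = X i.succ := AlgEquiv.apply_symm_apply _ _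
      rw [← e]; exact this
    have h3 := mem_pow_iff.mp h2 (single i.succ 1) (by rw [Finsupp.degree_single]; norm_num)
    simp [coeff_X] at h3

/-! ### The bijection of quotients -/

/-- When λ changes sign, composing with the exchange of y₁ and y₂ reduces to equal λ, where the
conjugacy is a rescaling. -/
theorem exists_smul_eq_of_conj {p q : ParamSpace}
    (h : Conj (normalFormField p) (normalFormField q)) :
    ∃ g : ℂˣ × Multiplicative (ZMod 2), g • p = q := by
  have aux : ∀ {q : ParamSpace}, Conj (normalFormField p) (normalFormField q) →
      q.lam = p.lam → ∃ θ : ℂˣ, θ • p = q := by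
    intro q h hlam
    obtain ⟨σ, hσ, hx, hinj⟩ := h.exists_related
    obtain ⟨θ, hθ, hac⟩ := exists_rescale_of_related hσ hx hinj hlam
    exact ⟨Units.mk0 θ hθ, ParamSpace.ext hlam.symm (hac 0).1.symm (hac 1).1.symm
      (hac 0).2.symm (hac 1).2.symm⟩
  obtain ⟨σ, hσ, hx, hinj⟩ := h.exists_related
  rcases lam_eq_or_of_related hσ hinj with hlam | hlam
  · obtain ⟨θ, hθ⟩ := aux h hlam
    exact ⟨(θ, 1), hθ⟩
  · obtain ⟨θ, hθ⟩ := aux (h.trans (conj_normalFormField_swap q)) (by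
      change -q.lam = p.lam
      rw [hlam, neg_neg])
    refine ⟨(θ, Multiplicative.ofAdd 1), ?_⟩
    change (θ • p.swap : ParamSpace) = q
    rw [← ParamSpace.swap_smul, hθ, ParamSpace.swap_swap]

theorem conj_of_smul (g : ℂˣ × Multiplicative (ZMod 2)) (p : ParamSpace) :
    Conj (normalFormField p) (normalFormField (g • p)) := by
  obtain ⟨θ, ε⟩ := g
  have h1 : Conj (normalFormField p) (normalFormField (ε • p)) := by
    change Conj _ (normalFormField (if ε.toAdd = 0 then p else p.swap))
    split_ifs
    · exact Conj.refl _
    · exact conj_normalFormField_swap p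
  exact h1.trans (conj_normalFormField_smul θ _)

theorem conj_iff_orbitRel (Y Z : SNnd) :
    Conj Y Z ↔ MulAction.orbitRel FiberedDiffeo SNnd Z Y := by
  rw [MulAction.orbitRel_apply, MulAction.mem_orbit_iff]
  exact exists_congr fun Φ => ⟨fun h => Subtype.ext h, fun h => congrArg Subtype.val h⟩

/-- Conjugacy classes of normal forms, as a function of the orbit of the parameters. -/
def classOfParam (c : MulAction.orbitRel.Quotient (ℂˣ × Multiplicative (ZMod 2)) ParamSpace) :
    MulAction.orbitRel.Quotient FiberedDiffeo SNnd :=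
  Quotient.map normalForm (fun p q h => by
    obtain ⟨g, rfl⟩ := h
    exact (conj_iff_orbitRel (normalForm q) (normalForm (g • q))).mp (conj_of_smul g q)) c

theorem classOfParam_bijective : Function.Bijective classOfParam := by
  constructor
  · intro c d h
    induction c using Quotient.inductionOn with | _ p => ?_
    induction d using Quotient.inductionOn with | _ q => ?_
    have h1 := Quotient.exact h
    obtain ⟨g, hg⟩ := exists_smul_eq_of_conj ((conj_iff_orbitRel _ _).mpr h1)
    exact Quotient.sound ⟨g, hg⟩
  · intro c
    induction c using Quotient.inductionOn with | _ Y => ?_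
    obtain ⟨p, hp⟩ := exists_conj_normalFormField Y.2
    exact ⟨Quotient.mk _ p,
      Quotient.sound ((conj_iff_orbitRel Y (normalForm p)).mp hp)⟩

end

end SaddleNode

theorem mainTheorem4 :
    ∃ e : MulAction.orbitRel.Quotient SaddleNode.FiberedDiffeo SaddleNode.SNnd ≃
        MulAction.orbitRel.Quotient (ℂˣ × Multiplicative (ZMod 2)) SaddleNode.ParamSpace,
      ∀ p : SaddleNode.ParamSpace,
        e (Quotient.mk _ (SaddleNode.normalForm p)) = Quotient.mk _ p :=
  -- The explicit direction is from parameters to classes, so the required bijection is its inverse.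
  ⟨(Equiv.ofBijective _ SaddleNode.classOfParam_bijective).symm, fun p =>
    (Equiv.ofBijective _ SaddleNode.classOfParam_bijective).symm_apply_apply (Quotient.mk _ p)⟩
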